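/- Let $V$ be a vector space over a field $\mathbb{F}$ with a linearly ordered basis $\mathbb{B}$ (finite or infinite), and let $p\in\mathbb{F}$, $p\neq 0$. For $a,b\in\mathbb{B}$ put $\theta_{a,b}=1$ if $a>b$ and $\theta_{a,b}=0$ otherwise, and let $\tau\colon V\otimes V\to V\otimes V$ be the linear map with $$\tau(a\otimes b)=(p^{\theta_{a,b}}-1)\,a\otimes b-p^{\theta_{b,a}}\,b\otimes a,\qquad a,b\in\mathbb{B}.$$ A \emph{braided vector space} is a vector space $W$ with an automorphism $\beta$ of $W\otimes W$ that satisfies the Yang--Baxter equation $(\beta\otimes\mathrm{id})(\mathrm{id}\otimes\beta)(\beta\otimes\mathrm{id})=(\mathrm{id}\otimes\beta)(\beta\otimes\mathrm{id})(\mathrm{id}\otimes\beta)$. A \emph{braided Hopf algebra} is a unital associative algebra $H$ with product $\nabla$ and unit $\eta$, together with a map $\beta$ making $H$ a braided vector space, a coassociative coproduct $\Delta\colon H\to H\otimes H$ with counit $\epsilon\colon H\to\mathbb{F}$, and an antipode $S\colon H\to H$, such that $\nabla(S\otimes\mathrm{id})\Delta=\eta\epsilon=\nabla(\mathrm{id}\otimes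 S)\Delta$, $\Delta\nabla=(\nabla\otimes\nabla)(\mathrm{id}\otimes\beta\otimes\mathrm{id})(\Delta\otimes\Delta)$, $\Delta(1)=1\otimes1$, $\epsilon$ is a unital algebra homomorphism, and all of $\nabla,\eta,\Delta,\epsilon,S$ commute with the braiding (for example $\beta(\nabla\otimes\mathrm{id})=(\mathrm{id}\otimes\nabla)(\beta\otimes\mathrm{id})(\mathrm{id}\otimes\beta)$, and similarly for the other maps, in either tensor factor). A morphism of braided Hopf algebras is a unital algebra homomorphism that commutes with $\beta$, $\Delta$, $\epsilon$ and $S$. An element $x\in H$ is \emph{primitive} if $\Delta x=x\otimes 1+1\otimes x$. For a linear map $i\colon V\to H$, the braiding $\beta$ of $H$ is \emph{induced by $\tau$} if $\beta(i\otimes i)=(i\otimes i)\tau$, $\beta(1\otimes x)=x\otimes 1$ and $\beta(x\otimes1)=1\otimes x$ for all $x\in H$, and $$\beta(\nabla\otimes\nabla)=(\nabla\otimes\nabla)(\mathrm{id}\otimes\beta\otimes\mathrm{id})(\beta\otimes\beta)(\mathrm{id}\otimes\beta\otimes\mathrm{id}).$$ Then $(V,\tau)$ is a braided vector space, and there are structures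 of braided Hopf algebra on the tensor algebra $T(V)$ and on the exterior algebra $\bigwedge V$, extending their usual algebra structures, such that: 1. in both $T(V)$ and $\bigwedge V$ all elements of $V$ are primitive and the braiding is induced by $\tau$; 2. the primitive elements of $T(V)$ in $T^2(V)=V\otimes V$ are exactly the linear combinations of the elements $ab+ba$, for $a<b$ in $\mathbb{B}$, and $a^2$, for $a\in\mathbb{B}$; 3. the canonical algebra homomorphism $T(V)\to\bigwedge V$ is a surjective morphism of braided Hopf algebras, and its kernel is the two-sided ideal of $T(V)$ generated by the elements $ab+ba$, for $a<b$ in $\mathbb{B}$, and $a^2$, for $a\in\mathbb{B}$. -/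

import Mathlib

open scoped TensorProduct

noncomputable section

namespace BraidedExterior

variable {F : Type*} [Field F]

section Tensor

variable {V : Type*} [AddCommGroup V] [Module F V]

/-- For `β : V ⊗ V → V ⊗ V`, the map `β ⊗ id` on `V ⊗ V ⊗ W` (bracketed to the right). -/
def braid₁₂ (W : Type*) [AddCommGroup W] [Module F W] (β : V ⊗[F] V →ₗ[F] V ⊗[F] V) :
    V ⊗[F] (V ⊗[F] W) →ₗ[F] V ⊗[F] (V ⊗[F] W) :=
  (TensorProduct.assoc F V V W).toLinearMap ∘ₗ β.rTensor W ∘ₗ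
    (TensorProduct.assoc F V V W).symm.toLinearMap

/-- The map `id ⊗ β` on `V ⊗ V ⊗ V` (bracketed to the right). -/
def braid₂₃ (β : V ⊗[F] V →ₗ[F] V ⊗[F] V) :
    V ⊗[F] (V ⊗[F] V) →ₗ[F] V ⊗[F] (V ⊗[F] V) :=
  β.lTensor V

/-- The map `id ⊗ β ⊗ id` on `(V ⊗ V) ⊗ (V ⊗ V)`. -/
def braidMiddle (β : V ⊗[F] V →ₗ[F] V ⊗[F] V) :
    (V ⊗[F] V) ⊗[F] (V ⊗[F] V) →ₗ[F] (V ⊗[F] V) ⊗[F] (V ⊗[F] V) :=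
  (TensorProduct.assoc F V V (V ⊗[F] V)).symm.toLinearMap ∘ₗ
    (braid₁₂ V β).lTensor V ∘ₗ (TensorProduct.assoc F V V (V ⊗[F] V)).toLinearMap

/-- `(V, τ)` is a braided vector space: `τ` is an automorphism of `V ⊗ V` that satisfies the
Yang–Baxter equation. -/
structure IsBraidedVectorSpace (τ : V ⊗[F] V →ₗ[F] V ⊗[F] V) : Prop where
  bijective : Function.Bijective τ
  yangBaxter : braid₁₂ V τ ∘ₗ braid₂₃ τ ∘ₗ braid₁₂ V τ = braid₂₃ τ ∘ₗ braid₁₂ V τ ∘ₗ braid₂₃ τ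

end Tensor

/-- A structure of braided Hopf algebra on a unital associative algebra `H`, whose product and unit
are those of `H`: a braiding, coproduct, counit and antipode which satisfy the Hopf axioms, all
structure maps being compatible with the braiding. -/
structure BraidedHopfStructure (F H : Type*) [Field F] [Ring H] [Algebra F H] where
  braiding : H ⊗[F] H →ₗ[F] H ⊗[F] H
  comul : H →ₗ[F] H ⊗[F] H
  counit : H →ₗ[F] F
  antipode : H →ₗ[F] H
  isBraided : IsBraidedVectorSpace braiding
  -- coassociativity
  coassoc : (TensorProduct.assoc F H H H).toLinearMap ∘ₗ comul.rTensor H ∘ₗ comul =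
    comul.lTensor H ∘ₗ comul
  -- counitality
  counit_left : (TensorProduct.lid F H).toLinearMap ∘ₗ counit.rTensor H ∘ₗ comul = LinearMap.id
  counit_right : (TensorProduct.rid F H).toLinearMap ∘ₗ counit.lTensor H ∘ₗ comul = LinearMap.id
  -- invertibility
  antipode_left : LinearMap.mul' F H ∘ₗ antipode.rTensor H ∘ₗ comul =
    Algebra.linearMap F H ∘ₗ counit
  antipode_right : LinearMap.mul' F H ∘ₗ antipode.lTensor H ∘ₗ comul =
    Algebra.linearMap F H ∘ₗ counit
  -- compatibility of the coproduct and the counit with the product and the unit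
  comul_mul : TensorProduct.map (LinearMap.mul' F H) (LinearMap.mul' F H) ∘ₗ
    braidMiddle braiding ∘ₗ TensorProduct.map comul comul = comul ∘ₗ LinearMap.mul' F H
  comul_one : comul 1 = 1 ⊗ₜ[F] 1
  counit_mul : ∀ x y : H, counit (x * y) = counit x * counit y
  counit_one : counit 1 = 1
  -- compatibility of the unit with the braiding
  braiding_one_left : ∀ x : H, braiding (1 ⊗ₜ[F] x) = x ⊗ₜ[F] 1
  braiding_one_right : ∀ x : H, braiding (x ⊗ₜ[F] 1) = 1 ⊗ₜ[F] x
  -- compatibility of the counit with the braiding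
  counit_braiding_left : (TensorProduct.lid F H).toLinearMap ∘ₗ counit.rTensor H ∘ₗ braiding =
    (TensorProduct.rid F H).toLinearMap ∘ₗ counit.lTensor H
  counit_braiding_right : (TensorProduct.rid F H).toLinearMap ∘ₗ counit.lTensor H ∘ₗ braiding =
    (TensorProduct.lid F H).toLinearMap ∘ₗ counit.rTensor H
  -- compatibility of the antipode with the braiding
  braiding_antipode_left : braiding ∘ₗ antipode.rTensor H = antipode.lTensor H ∘ₗ braiding
  braiding_antipode_right : braiding ∘ₗ antipode.lTensor H = antipode.rTensor H ∘ₗ braiding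
  -- compatibility of the product with the braiding
  braiding_mul_left :
    braiding ∘ₗ (LinearMap.mul' F H).rTensor H ∘ₗ (TensorProduct.assoc F H H H).symm.toLinearMap =
      (LinearMap.mul' F H).lTensor H ∘ₗ braid₁₂ H braiding ∘ₗ braid₂₃ braiding
  braiding_mul_right :
    braiding ∘ₗ (LinearMap.mul' F H).lTensor H =
      (LinearMap.mul' F H).rTensor H ∘ₗ (TensorProduct.assoc F H H H).symm.toLinearMap ∘ₗ
        braid₂₃ braiding ∘ₗ braid₁₂ H braiding
  -- compatibility of the coproduct with the braiding
  comul_braiding_right :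
    comul.lTensor H ∘ₗ braiding = braid₁₂ H braiding ∘ₗ braid₂₃ braiding ∘ₗ
      (TensorProduct.assoc F H H H).toLinearMap ∘ₗ comul.rTensor H
  comul_braiding_left :
    (TensorProduct.assoc F H H H).toLinearMap ∘ₗ comul.rTensor H ∘ₗ braiding =
      braid₂₃ braiding ∘ₗ braid₁₂ H braiding ∘ₗ comul.lTensor H

namespace BraidedHopfStructure

variable {H K : Type*} [Ring H] [Algebra F H] [Ring K] [Algebra F K]

/-- `x` is primitive: `Δ x = x ⊗ 1 + 1 ⊗ x`. -/
def IsPrimitive (S : BraidedHopfStructure F H) (x : H) : Prop :=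
  S.comul x = x ⊗ₜ[F] 1 + 1 ⊗ₜ[F] x

/-- The braiding of `H` is induced by `τ : V ⊗ V → V ⊗ V` along `i : V → H`: it restricts to `τ`,
and it is compatible with the unit and satisfies the fusion relation for the product. -/
structure IsInducedBy {V : Type*} [AddCommGroup V] [Module F V] (S : BraidedHopfStructure F H)
    (i : V →ₗ[F] H) (τ : V ⊗[F] V →ₗ[F] V ⊗[F] V) : Prop where
  restrict : S.braiding ∘ₗ TensorProduct.map i i = TensorProduct.map i i ∘ₗ τ
  unit_left : ∀ x : H, S.braiding (1 ⊗ₜ[F] x) = x ⊗ₜ[F] 1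
  unit_right : ∀ x : H, S.braiding (x ⊗ₜ[F] 1) = 1 ⊗ₜ[F] x
  fusion : S.braiding ∘ₗ TensorProduct.map (LinearMap.mul' F H) (LinearMap.mul' F H) =
    TensorProduct.map (LinearMap.mul' F H) (LinearMap.mul' F H) ∘ₗ braidMiddle S.braiding ∘ₗ
      TensorProduct.map S.braiding S.braiding ∘ₗ braidMiddle S.braiding

/-- A homomorphism of algebras `f` is a morphism of braided Hopf algebras. -/
structure IsHom (S : BraidedHopfStructure F H) (T : BraidedHopfStructure F K) (f : H →ₐ[F] K) :
    Prop where
  braiding : TensorProduct.map f.toLinearMap f.toLinearMap ∘ₗ S.braiding =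
    T.braiding ∘ₗ TensorProduct.map f.toLinearMap f.toLinearMap
  comul : TensorProduct.map f.toLinearMap f.toLinearMap ∘ₗ S.comul = T.comul ∘ₗ f.toLinearMap
  counit : T.counit ∘ₗ f.toLinearMap = S.counit
  antipode : f.toLinearMap ∘ₗ S.antipode = T.antipode ∘ₗ f.toLinearMap

end BraidedHopfStructure

section Hecke

variable {I : Type*} [LinearOrder I]

/-- The Heaviside symbol: `1` if `a > b` and `0` otherwise. -/
def theta (a b : I) : ℕ := if b < a then 1 else 0

variable {V : Type*} [AddCommGroup V] [Module F V]

/-- The Hecke type braiding of a space with a linearly ordered basis: on basis vectors,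
`a ⊗ b ↦ (p ^ θ(a,b) - 1) a ⊗ b - p ^ θ(b,a) b ⊗ a`. -/
def heckeBraiding (B : Module.Basis I F V) (p : F) : V ⊗[F] V →ₗ[F] V ⊗[F] V :=
  (B.tensorProduct B).constr F fun ab : I × I =>
    (p ^ theta ab.1 ab.2 - 1) • (B ab.1 ⊗ₜ[F] B ab.2) -
      p ^ theta ab.2 ab.1 • (B ab.2 ⊗ₜ[F] B ab.1)

/-- The elements `ab + ba`, for basis vectors `a < b`, and `a²`, for basis vectors `a`, of the
tensor algebra. -/
def exteriorRelations (B : Module.Basis I F V) : Set (TensorAlgebra F V) :=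
  {w | ∃ a b : I, a < b ∧ w = TensorAlgebra.ι F (B a) * TensorAlgebra.ι F (B b) +
      TensorAlgebra.ι F (B b) * TensorAlgebra.ι F (B a)} ∪
    {w | ∃ a : I, w = TensorAlgebra.ι F (B a) * TensorAlgebra.ι F (B a)}

end Hecke

end BraidedExterior

end

/-!
The braiding, the coproduct, the counit and the antipode are constructed at once for every algebra
`A` generated by a map `i : V → A` with the universal property of `T(V)` or of `⋀ V`
(`IsPresented`): linear maps from `V` to an algebra, with values of square zero in the second case,
extend to `A`. Besides the invertibility of `τ`, only the Yang–Baxter equation is needed and the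
fact that the kernel of `id + τ` is the space of symmetric tensors, spanned by the squares `v ⊗ v`
(`IsSkewBraiding`).

*Construction.* A map out of `A` that is defined by recursion on words, with the generator `v`
acting as an operator `P v`, is the same as an extension of `P` to a homomorphism from `A` to an
algebra of endomorphisms. For `A = ⋀ V` one has to check `P v * P v = 0`. In this way `τ` extends
to `A ⊗ V → V ⊗ A` (`exists_crossing`) and then to the braiding `β` of `A ⊗ A`
(`exists_inducedBraiding`); here `P v * P v = 0` since the product of `⋀ V`, restricted to `V ⊗ V`,
factors through `id + τ`, which commutes with the crossings by the Yang–Baxter equation and kills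
`v ⊗ v`. The coproduct is the extension of left multiplication by `v ⊗ 1 + 1 ⊗ v` in the braided
tensor square (`exists_comul`), and the antipode is the extension of the operators
`y ↦ -∇ β (v ⊗ y)` (`exists_antipode`).

*Axioms.* Most axioms say that a map `f : W → W'` commutes with moving a factor `A` across `W` and
across `W'` (`NatAt`). Such maps are closed under composition and tensor products, and commuting
with a product of elements follows from commuting with the factors, so everything is reduced to
generators: this gives the Yang–Baxter equation (`IsInducedBraiding.natAt_self`) and the
compatibility of the coproduct, the counit and the antipode with `β`. The inverse of `β` is the
braiding induced by the inverse of `τ` (`IsInducedBraiding.inverse`); the axioms where a map is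
moved across from the other side are the same statements for `β⁻¹`, so that mirror images of the
arguments are not needed. Coassociativity, counitality and the antipode axioms follow by induction
on words.

*The Hecke braiding.* For `a < b` the map `τ` sends `a ⊗ b` to `-p b ⊗ a` and `b ⊗ a` to
`(p - 1) b ⊗ a - a ⊗ b`, so that `(τ + 1)(τ - p) = 0`, and the kernel of `id + τ` is spanned by the
tensors `a ⊗ b + b ⊗ a` and `a ⊗ a`, for every `p` (`exists_sub_mem_span_skewTensors`). For an
element `w` of degree two of `T(V)`, represented by `t ∈ V ⊗ V`, one has
`Δ w = w ⊗ 1 + 1 ⊗ w + (t + τ t)`, whence the description of the primitive elements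
(`setOf_isPrimitive_eq_span_exteriorRelations`). A bilinear map which is alternating on a basis is
alternating, so these elements also generate the kernel of `T(V) → ⋀ V` (`ker_toExterior`).
-/

noncomputable section

namespace BraidedExterior

/-! ### Crossings of a vector space with an algebra -/

section Crossing

variable {F : Type*} [Field F] {A : Type*} [Ring A] [Algebra F A]
  {U W W' W'' X : Type*} [AddCommGroup U] [Module F U] [AddCommGroup W] [Module F W]
  [AddCommGroup W'] [Module F W'] [AddCommGroup W''] [Module F W''] [AddCommGroup X] [Module F X]

/-- Right multiplication by `y` on the algebra factor of `W ⊗ A`. -/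
def rmul (W : Type*) [AddCommGroup W] [Module F W] (y : A) : W ⊗[F] A →ₗ[F] W ⊗[F] A :=
  (LinearMap.mulRight F y).lTensor W

/-- Left multiplication by `x` on the algebra factor of `A ⊗ W`. -/
def lmul (W : Type*) [AddCommGroup W] [Module F W] (x : A) : A ⊗[F] W →ₗ[F] A ⊗[F] W :=
  (LinearMap.mulLeft F x).rTensor W

@[simp] lemma rmul_tmul (y : A) (w : W) (a : A) :
    rmul (F := F) W y (w ⊗ₜ a) = w ⊗ₜ (a * y) := rfl

@[simp] lemma lmul_tmul (x : A) (a : A) (w : W) :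
    lmul (F := F) W x (a ⊗ₜ w) = (x * a) ⊗ₜ w := rfl

lemma rmul_one (z : W ⊗[F] A) : rmul W 1 z = z := by simp [rmul]

lemma lmul_one (z : A ⊗[F] W) : lmul W 1 z = z := by simp [lmul]

lemma rmul_rmul (x y : A) (z : W ⊗[F] A) : rmul W x (rmul W y z) = rmul W (y * x) z := by
  simp [rmul, LinearMap.mulRight_mul, LinearMap.lTensor_comp_apply]

lemma lmul_lmul (x y : A) (z : A ⊗[F] W) : lmul W x (lmul W y z) = lmul W (x * y) z := by
  simp [lmul, LinearMap.mulLeft_mul, LinearMap.rTensor_comp_apply]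

lemma lmul_rmul (x y : A) (z : A ⊗[F] A) : lmul A x (rmul A y z) = rmul A y (lmul A x z) := by
  induction z using TensorProduct.induction_on with
  | zero => simp only [map_zero]
  | add _ _ h₁ h₂ => simp only [map_add, h₁, h₂]
  | tmul a b => simp

lemma rTensor_rmul (f : W →ₗ[F] W') (y : A) (z : W ⊗[F] A) :
    f.rTensor A (rmul W y z) = rmul W' y (f.rTensor A z) := by
  induction z using TensorProduct.induction_on with
  | zero => simp only [map_zero]
  | add _ _ h₁ h₂ => simp only [map_add, h₁, h₂]
  | tmul a b => simp

/-- For `c : U ⊗ W → W' ⊗ A` and `u : U`, the map `W ⊗ A → W' ⊗ A`, `w ⊗ y ↦ c (u ⊗ w) y`. -/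
def slide (c : U ⊗[F] W →ₗ[F] W' ⊗[F] A) : U →ₗ[F] W ⊗[F] A →ₗ[F] W' ⊗[F] A :=
  TensorProduct.curry ((LinearMap.mul' F A).lTensor W' ∘ₗ
    (TensorProduct.assoc F W' A A).toLinearMap ∘ₗ c.rTensor A ∘ₗ
      (TensorProduct.assoc F U W A).symm.toLinearMap)

/-- For `c : W ⊗ U → A ⊗ W'` and `u : U`, the map `A ⊗ W → A ⊗ W'`, `x ⊗ w ↦ x c (w ⊗ u)`. -/
def slideR (c : W ⊗[F] U →ₗ[F] A ⊗[F] W') : U →ₗ[F] A ⊗[F] W →ₗ[F] A ⊗[F] W' :=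
  (TensorProduct.curry ((LinearMap.mul' F A).rTensor W' ∘ₗ
    (TensorProduct.assoc F A A W').symm.toLinearMap ∘ₗ c.lTensor A ∘ₗ
      (TensorProduct.assoc F A W U).toLinearMap)).flip

@[simp] lemma slide_tmul (c : U ⊗[F] W →ₗ[F] W' ⊗[F] A) (u : U) (w : W) (y : A) :
    slide c u (w ⊗ₜ y) = rmul W' y (c (u ⊗ₜ w)) := by
  simp only [slide, TensorProduct.curry_apply, LinearMap.comp_apply, LinearEquiv.coe_coe,
    TensorProduct.assoc_symm_tmul, LinearMap.rTensor_tmul]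
  generalize c (u ⊗ₜ w) = z
  induction z using TensorProduct.induction_on with
  | zero => simp only [map_zero, TensorProduct.zero_tmul]
  | add _ _ h₁ h₂ => simp only [map_add, TensorProduct.add_tmul, h₁, h₂]
  | tmul a b => simp

@[simp] lemma slideR_tmul (c : W ⊗[F] U →ₗ[F] A ⊗[F] W') (u : U) (w : W) (x : A) :
    slideR c u (x ⊗ₜ w) = lmul W' x (c (w ⊗ₜ u)) := by
  simp only [slideR, LinearMap.flip_apply, TensorProduct.curry_apply, LinearMap.comp_apply,
    LinearEquiv.coe_coe, TensorProduct.assoc_tmul, LinearMap.lTensor_tmul]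
  generalize c (w ⊗ₜ u) = z
  induction z using TensorProduct.induction_on with
  | zero => simp only [map_zero, TensorProduct.tmul_zero]
  | add _ _ h₁ h₂ => simp only [map_add, TensorProduct.tmul_add, h₁, h₂]
  | tmul a b => simp

lemma slide_rmul (c : U ⊗[F] W →ₗ[F] W' ⊗[F] A) (u : U) (y : A) (z : W ⊗[F] A) :
    slide c u (rmul W y z) = rmul W' y (slide c u z) := by
  induction z using TensorProduct.induction_on with
  | zero => simp only [map_zero]
  | add _ _ h₁ h₂ => simp only [map_add, h₁, h₂]
  | tmul a b => simp [rmul_rmul]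

/-- The crossing of `W ⊗ W'` with `A` composed of crossings of `W` and of `W'` with `A`. -/
def crossTensor (c : A ⊗[F] W →ₗ[F] W ⊗[F] A) (c' : A ⊗[F] W' →ₗ[F] W' ⊗[F] A) :
    A ⊗[F] (W ⊗[F] W') →ₗ[F] (W ⊗[F] W') ⊗[F] A :=
  (TensorProduct.assoc F W W' A).symm.toLinearMap ∘ₗ c'.lTensor W ∘ₗ
    (TensorProduct.assoc F W A W').toLinearMap ∘ₗ c.rTensor W' ∘ₗ
      (TensorProduct.assoc F A W W').symm.toLinearMap

/-- The second half of `crossTensor`: `w ⊗ a ↦ w ⊗ c' (a ⊗ w')`. -/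
def crossTail (W : Type*) [AddCommGroup W] [Module F W] (c' : A ⊗[F] W' →ₗ[F] W' ⊗[F] A) (w' : W') :
    W ⊗[F] A →ₗ[F] (W ⊗[F] W') ⊗[F] A :=
  (TensorProduct.assoc F W W' A).symm.toLinearMap ∘ₗ
    (c' ∘ₗ (TensorProduct.mk F A W').flip w').lTensor W

lemma assoc_symm_tmul_eq (w : W) (z : W' ⊗[F] W'') :
    (TensorProduct.assoc F W W' W'').symm (w ⊗ₜ z) =
      (TensorProduct.mk F W W' w).rTensor W'' z := by
  induction z using TensorProduct.induction_on with
  | zero => simp only [map_zero, TensorProduct.tmul_zero]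
  | add _ _ h₁ h₂ => simp only [map_add, TensorProduct.tmul_add, h₁, h₂]
  | tmul a b => simp

lemma assoc_tmul_eq (z : W ⊗[F] W') (w : W'') :
    TensorProduct.assoc F W W' W'' (z ⊗ₜ w) =
      ((TensorProduct.mk F W' W'').flip w).lTensor W z := by
  induction z using TensorProduct.induction_on with
  | zero => simp only [map_zero, TensorProduct.zero_tmul]
  | add _ _ h₁ h₂ => simp only [map_add, TensorProduct.add_tmul, h₁, h₂]
  | tmul a b => simp

@[simp] lemma crossTail_tmul (c' : A ⊗[F] W' →ₗ[F] W' ⊗[F] A) (w' : W') (w : W) (a : A) :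
    crossTail W c' w' (w ⊗ₜ a) = (TensorProduct.mk F W W' w).rTensor A (c' (a ⊗ₜ w')) := by
  simp [crossTail, assoc_symm_tmul_eq]

lemma crossTensor_tmul (c : A ⊗[F] W →ₗ[F] W ⊗[F] A) (c' : A ⊗[F] W' →ₗ[F] W' ⊗[F] A)
    (a : A) (w : W) (w' : W') :
    crossTensor c c' (a ⊗ₜ (w ⊗ₜ w')) = crossTail W c' w' (c (a ⊗ₜ w)) := by
  simp only [crossTensor, LinearMap.comp_apply, LinearEquiv.coe_coe,
    TensorProduct.assoc_symm_tmul, LinearMap.rTensor_tmul, assoc_tmul_eq, crossTail]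
  generalize c (a ⊗ₜ w) = z
  rw [← LinearMap.comp_apply (LinearMap.lTensor W c'), ← LinearMap.lTensor_comp]

/-- `c` is compatible with the product of `A` at `w`: moving `a b` across `w` means moving first `b`
and then `a`. -/
def CrossMulAt (c : A ⊗[F] W →ₗ[F] W ⊗[F] A) (w : W) : Prop :=
  ∀ a b : A, c ((a * b) ⊗ₜ w) = slide c a (c (b ⊗ₜ w))

lemma CrossMulAt.crossTensor {c : A ⊗[F] W →ₗ[F] W ⊗[F] A} {c' : A ⊗[F] W' →ₗ[F] W' ⊗[F] A}
    {w : W} {w' : W'} (h : CrossMulAt c w) (h' : CrossMulAt c' w') :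
    CrossMulAt (crossTensor c c') (w ⊗ₜ w') := by
  intro a b
  rw [crossTensor_tmul, crossTensor_tmul, h]
  -- `Θ y` is the map `u ⊗ a ↦ u ⊗ slide c' a y`, through which both sides factor.
  let Θ : W' ⊗[F] A → W ⊗[F] A →ₗ[F] (W ⊗[F] W') ⊗[F] A := fun y =>
    (TensorProduct.assoc F W W' A).symm.toLinearMap ∘ₗ ((slide c').flip y).lTensor W
  have hΘ : ∀ y u a, Θ y (u ⊗ₜ a) = (TensorProduct.mk F W W' u).rTensor A (slide c' a y) := by
    intro y u a
    simp [Θ, assoc_symm_tmul_eq]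
  generalize c (b ⊗ₜ w) = z
  induction z using TensorProduct.induction_on with
  | zero => simp only [map_zero]
  | add _ _ h₁ h₂ => simp only [map_add, h₁, h₂]
  | tmul u b' =>
    simp only [slide_tmul, crossTail_tmul]
    trans Θ (c' (b' ⊗ₜ w')) (c (a ⊗ₜ u))
    · generalize c (a ⊗ₜ u) = s
      induction s using TensorProduct.induction_on with
      | zero => simp only [map_zero]
      | add _ _ h₁ h₂ => simp only [map_add, h₁, h₂]
      | tmul u' a' => rw [rmul_tmul, crossTail_tmul, hΘ, h']
    · generalize c' (b' ⊗ₜ w') = y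
      induction y using TensorProduct.induction_on with
      | zero => simp [Θ]
      | add _ _ h₁ h₂ =>
        simp only [map_add, ← h₁, ← h₂]
        simp [Θ, LinearMap.lTensor_add]
      | tmul w'' b'' =>
        simp only [LinearMap.rTensor_tmul, TensorProduct.mk_apply, slide_tmul, crossTensor_tmul]
        generalize c (a ⊗ₜ u) = s
        induction s using TensorProduct.induction_on with
        | zero => simp only [map_zero]
        | add _ _ h₁ h₂ => simp only [map_add, h₁, h₂]
        | tmul u' a' => rw [hΘ, crossTail_tmul, slide_tmul, rTensor_rmul]

/-- `f : W → W'` commutes at `w` with the crossings: one may apply `f` before or after moving an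
element of `A` across. -/
def NatAt (c : A ⊗[F] W →ₗ[F] W ⊗[F] A) (c' : A ⊗[F] W' →ₗ[F] W' ⊗[F] A) (f : W →ₗ[F] W')
    (w : W) : Prop :=
  ∀ a : A, f.rTensor A (c (a ⊗ₜ w)) = c' (a ⊗ₜ f w)

section NatAt

variable {W₁ W₂ W₃ W₁' W₂' : Type*} [AddCommGroup W₁] [Module F W₁] [AddCommGroup W₂] [Module F W₂]
  [AddCommGroup W₃] [Module F W₃]
  [AddCommGroup W₁'] [Module F W₁'] [AddCommGroup W₂'] [Module F W₂']
  {c : A ⊗[F] W →ₗ[F] W ⊗[F] A} {c' : A ⊗[F] W' →ₗ[F] W' ⊗[F] A}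
  {c'' : A ⊗[F] W'' →ₗ[F] W'' ⊗[F] A}
  {c₁ : A ⊗[F] W₁ →ₗ[F] W₁ ⊗[F] A} {c₂ : A ⊗[F] W₂ →ₗ[F] W₂ ⊗[F] A}
  {c₃ : A ⊗[F] W₃ →ₗ[F] W₃ ⊗[F] A}
  {c₁' : A ⊗[F] W₁' →ₗ[F] W₁' ⊗[F] A} {c₂' : A ⊗[F] W₂' →ₗ[F] W₂' ⊗[F] A}

lemma NatAt.zero (f : W →ₗ[F] W') : NatAt c c' f 0 := fun a => by simp

lemma NatAt.add {f : W →ₗ[F] W'} {w₁ w₂ : W} (h₁ : NatAt c c' f w₁) (h₂ : NatAt c c' f w₂) :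
    NatAt c c' f (w₁ + w₂) := fun a => by
  simp only [map_add, TensorProduct.tmul_add, h₁ a, h₂ a]

lemma NatAt.smul {f : W →ₗ[F] W'} {w : W} (r : F) (h : NatAt c c' f w) :
    NatAt c c' f (r • w) := fun a => by
  simp only [map_smul, TensorProduct.tmul_smul, h a]

lemma natAt_id (w : W) : NatAt c c LinearMap.id w := fun a => by simp

lemma natAt_of_forall_tmul {c : A ⊗[F] (W₁ ⊗[F] W₂) →ₗ[F] (W₁ ⊗[F] W₂) ⊗[F] A}
    {f : W₁ ⊗[F] W₂ →ₗ[F] W'} (h : ∀ u v, NatAt c c' f (u ⊗ₜ v)) (w : W₁ ⊗[F] W₂) :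
    NatAt c c' f w := by
  induction w using TensorProduct.induction_on with
  | zero => exact NatAt.zero f
  | add _ _ h₁ h₂ => exact h₁.add h₂
  | tmul u v => exact h u v

lemma NatAt.comp {g : W' →ₗ[F] W''} {f : W →ₗ[F] W'} {w : W} (hg : NatAt c' c'' g (f w))
    (hf : NatAt c c' f w) : NatAt c c'' (g ∘ₗ f) w := fun a => by
  rw [LinearMap.rTensor_comp_apply, hf, hg, LinearMap.comp_apply]

/-- Naturality descends along `f`; with `f` the product of `A`, it passes to products. -/
lemma NatAt.of_comp {g : W' →ₗ[F] W''} {f : W →ₗ[F] W'} {w : W} (h : NatAt c c'' (g ∘ₗ f) w)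
    (hf : NatAt c c' f w) : NatAt c' c'' g (f w) := fun a => by
  rw [← hf, ← LinearMap.rTensor_comp_apply, h, LinearMap.comp_apply]

/-- Compatibility with the product of `A` is transported along natural maps. -/
lemma NatAt.crossMulAt {f : W →ₗ[F] W'} {w : W} (hf : ∀ w, NatAt c c' f w) (h : CrossMulAt c w) :
    CrossMulAt c' (f w) := by
  intro a b
  rw [← hf, ← hf, h]
  generalize c (b ⊗ₜ w) = z
  induction z using TensorProduct.induction_on with
  | zero => simp only [map_zero]
  | add _ _ h₁ h₂ => simp only [map_add, h₁, h₂]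
  | tmul u y => rw [slide_tmul, rTensor_rmul, hf, LinearMap.rTensor_tmul, slide_tmul]

lemma NatAt.map {f : W₁ →ₗ[F] W₁'} {g : W₂ →ₗ[F] W₂'} {u : W₁} {v : W₂} (hf : NatAt c₁ c₁' f u)
    (hg : NatAt c₂ c₂' g v) :
    NatAt (crossTensor c₁ c₂) (crossTensor c₁' c₂') (TensorProduct.map f g) (u ⊗ₜ v) := by
  intro a
  rw [crossTensor_tmul, TensorProduct.map_tmul, crossTensor_tmul, ← hf]
  generalize c₁ (a ⊗ₜ u) = z
  induction z using TensorProduct.induction_on with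
  | zero => simp only [map_zero]
  | add _ _ h₁ h₂ => simp only [map_add, h₁, h₂]
  | tmul u' a' =>
    rw [crossTail_tmul, LinearMap.rTensor_tmul, crossTail_tmul, ← hg,
      ← LinearMap.rTensor_comp_apply, ← LinearMap.rTensor_comp_apply]
    congr 1

lemma natAt_map {f : W₁ →ₗ[F] W₁'} {g : W₂ →ₗ[F] W₂'} (hf : ∀ u, NatAt c₁ c₁' f u)
    (hg : ∀ v, NatAt c₂ c₂' g v) (w : W₁ ⊗[F] W₂) :
    NatAt (crossTensor c₁ c₂) (crossTensor c₁' c₂') (TensorProduct.map f g) w :=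
  natAt_of_forall_tmul (fun u v => (hf u).map (hg v)) w

lemma natAt_assoc_aux (u : W₁) (v : W₂) (w : W₃) (a : A) :
    (TensorProduct.assoc F W₁ W₂ W₃).toLinearMap.rTensor A
      (crossTensor (crossTensor c₁ c₂) c₃ (a ⊗ₜ ((u ⊗ₜ v) ⊗ₜ w))) =
    crossTensor c₁ (crossTensor c₂ c₃) (a ⊗ₜ (u ⊗ₜ (v ⊗ₜ w))) := by
  rw [crossTensor_tmul, crossTensor_tmul, crossTensor_tmul]
  generalize c₁ (a ⊗ₜ u) = z
  induction z using TensorProduct.induction_on with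
  | zero => simp only [map_zero]
  | add _ _ h₁ h₂ => simp only [map_add, h₁, h₂]
  | tmul u' a' =>
    rw [crossTail_tmul, crossTail_tmul, crossTensor_tmul]
    generalize c₂ (a' ⊗ₜ v) = z
    induction z using TensorProduct.induction_on with
    | zero => simp only [map_zero]
    | add _ _ h₁ h₂ => simp only [map_add, h₁, h₂]
    | tmul v' a'' =>
      rw [LinearMap.rTensor_tmul, crossTail_tmul, crossTail_tmul,
        ← LinearMap.rTensor_comp_apply, ← LinearMap.rTensor_comp_apply]
      congr 1

lemma natAt_assoc (w : (W₁ ⊗[F] W₂) ⊗[F] W₃) :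
    NatAt (crossTensor (crossTensor c₁ c₂) c₃) (crossTensor c₁ (crossTensor c₂ c₃))
      (TensorProduct.assoc F W₁ W₂ W₃).toLinearMap w := by
  refine natAt_of_forall_tmul (fun u w => ?_) w
  induction u using TensorProduct.induction_on with
  | zero => rw [TensorProduct.zero_tmul]; exact NatAt.zero _
  | add _ _ h₁ h₂ => rw [TensorProduct.add_tmul]; exact h₁.add h₂
  | tmul u v => exact natAt_assoc_aux u v w

lemma natAt_assoc_symm (w : W₁ ⊗[F] (W₂ ⊗[F] W₃)) :
    NatAt (crossTensor c₁ (crossTensor c₂ c₃)) (crossTensor (crossTensor c₁ c₂) c₃)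
      (TensorProduct.assoc F W₁ W₂ W₃).symm.toLinearMap w := by
  intro a
  apply (TensorProduct.assoc F W₁ W₂ W₃).rTensor A |>.injective
  have := natAt_assoc (c₁ := c₁) (c₂ := c₂) (c₃ := c₃)
    ((TensorProduct.assoc F W₁ W₂ W₃).symm w) a
  simp only [LinearEquiv.coe_coe, LinearEquiv.apply_symm_apply] at this
  simp only [LinearEquiv.coe_coe]
  erw [this]
  generalize crossTensor c₁ (crossTensor c₂ c₃) (a ⊗ₜ w) = z
  exact ((TensorProduct.assoc F W₁ W₂ W₃).rTensor A).apply_symm_apply z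

end NatAt

/-- `c : A ⊗ W → W ⊗ A` is compatible with the unit and the product of `A`. -/
structure IsCrossing (c : A ⊗[F] W →ₗ[F] W ⊗[F] A) : Prop where
  one : ∀ w, c (1 ⊗ₜ w) = w ⊗ₜ 1
  mul : ∀ w, CrossMulAt c w

lemma IsCrossing.crossTensor {c : A ⊗[F] W →ₗ[F] W ⊗[F] A} {c' : A ⊗[F] W' →ₗ[F] W' ⊗[F] A}
    (h : IsCrossing c) (h' : IsCrossing c') : IsCrossing (crossTensor c c') where
  one w := by
    induction w using TensorProduct.induction_on with
    | zero => simp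
    | add _ _ h₁ h₂ => simp only [TensorProduct.tmul_add, map_add, h₁, h₂, TensorProduct.add_tmul]
    | tmul u v => simp [crossTensor_tmul, h.one, h'.one]
  mul w := by
    induction w using TensorProduct.induction_on with
    | zero => intro a b; simp
    | add _ _ h₁ h₂ => intro a b; simp only [TensorProduct.tmul_add, map_add, h₁ a b, h₂ a b]
    | tmul u v => exact (h.mul u).crossTensor (h'.mul v)

lemma mem_of_adjoin_eq_top {V : Type*} [AddCommGroup V] [Module F V] {i : V →ₗ[F] A}
    (hi : Algebra.adjoin F (Set.range i) = ⊤) {P : A → Prop} (one : P 1) (gen : ∀ v, P (i v))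
    (add : ∀ x y, P x → P y → P (x + y)) (smul : ∀ (r : F) x, P x → P (r • x))
    (mul : ∀ x y, P x → P y → P (x * y)) (x : A) : P x := by
  have hx : x ∈ Algebra.adjoin F (Set.range i) := by rw [hi]; trivial
  induction hx using Algebra.adjoin_induction with
  | mem x hx => obtain ⟨v, rfl⟩ := hx; exact gen v
  | algebraMap r => rw [Algebra.algebraMap_eq_smul_one]; exact smul r 1 one
  | add x y _ _ hx hy => exact add x y hx hy
  | mul x y _ _ hx hy => exact mul x y hx hy

/-- Induction along words in the generators: `P` is only required to be stable under left
multiplication by generators. -/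
lemma mem_of_gen_mul {V : Type*} [AddCommGroup V] [Module F V] {i : V →ₗ[F] A}
    (hi : Algebra.adjoin F (Set.range i) = ⊤) {P : A → Prop} (one : P 1)
    (add : ∀ x y, P x → P y → P (x + y)) (smul : ∀ (r : F) x, P x → P (r • x))
    (gen_mul : ∀ v x, P x → P (i v * x)) (x : A) : P x := by
  have key : ∀ x, ∀ y, P y → P (x * y) := by
    refine mem_of_adjoin_eq_top hi (fun y hy => by rwa [one_mul]) gen_mul ?_ ?_ ?_
    · intro x y hx hy z hz
      rw [add_mul]
      exact add _ _ (hx z hz) (hy z hz)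
    · intro r x hx z hz
      rw [smul_mul_assoc]
      exact smul _ _ (hx z hz)
    · intro x y hx hy z hz
      rw [mul_assoc]
      exact hx _ (hy _ hz)
  simpa using key x 1 one

/-- Naturality of `f : W → W'` has to be checked only for the crossings of generators of `A`. -/
lemma natAt_of_gen {V : Type*} [AddCommGroup V] [Module F V] {i : V →ₗ[F] A}
    (hi : Algebra.adjoin F (Set.range i) = ⊤) {c : A ⊗[F] W →ₗ[F] W ⊗[F] A}
    {c' : A ⊗[F] W' →ₗ[F] W' ⊗[F] A} (hc : IsCrossing c) (hc' : IsCrossing c') {f : W →ₗ[F] W'}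
    (h : ∀ v w, f.rTensor A (c (i v ⊗ₜ w)) = c' (i v ⊗ₜ f w)) (w : W) : NatAt c c' f w := by
  intro a
  revert w
  refine mem_of_adjoin_eq_top hi (P := fun a => ∀ w, f.rTensor A (c (a ⊗ₜ w)) = c' (a ⊗ₜ f w))
    ?_ h ?_ ?_ ?_ a
  · intro w
    simp [hc.one, hc'.one]
  · intro x y hx hy w
    simp only [TensorProduct.add_tmul, map_add, hx, hy]
  · intro r x hx w
    simp only [← TensorProduct.smul_tmul', map_smul, hx]
  · intro x y hx hy w
    rw [hc.mul, hc'.mul, ← hy]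
    generalize c (y ⊗ₜ w) = z
    induction z using TensorProduct.induction_on with
    | zero => simp only [map_zero]
    | add _ _ h₁ h₂ => simp only [map_add, h₁, h₂]
    | tmul u b => rw [slide_tmul, rTensor_rmul, hx, LinearMap.rTensor_tmul, slide_tmul]

end Crossing

/-! ### Extension of a braiding to an algebra generated by `V` -/

section Braiding

universe u v

variable {F : Type u} [Field F] {V : Type v} [AddCommGroup V] [Module F V]
  {A : Type (max u v)} [Ring A] [Algebra F A]

/-- `A` is generated by the image of `i : V → A`, and a linear map from `V` to an algebra extends to
`A`, under the condition, if `Q` holds, that all values have square zero. For `Q` false this is the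
universal property of the tensor algebra, and for `Q` true that of the exterior algebra. -/
structure IsPresented (i : V →ₗ[F] A) (Q : Prop) : Prop where
  adjoin : Algebra.adjoin F (Set.range i) = ⊤
  sq : Q → ∀ v, i v * i v = 0
  lift : ∀ (C : Type (max u v)) [Ring C] [Algebra F C] (f : V →ₗ[F] C),
    (Q → ∀ v, f v * f v = 0) → ∃ g : A →ₐ[F] C, ∀ v, g (i v) = f v

/-- A braiding `τ` of `V` which is `-1` on squares `v ⊗ v`, where, conversely, `id + τ` is injective
modulo the squares: up to squares, it has the left inverse `s`. -/
structure IsSkewBraiding (τ : V ⊗[F] V →ₗ[F] V ⊗[F] V) : Prop where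
  yangBaxter : braid₁₂ V τ ∘ₗ braid₂₃ τ ∘ₗ braid₁₂ V τ = braid₂₃ τ ∘ₗ braid₁₂ V τ ∘ₗ braid₂₃ τ
  sq : ∀ v, τ (v ⊗ₜ v) = -(v ⊗ₜ v)
  factor : ∃ s : V ⊗[F] V →ₗ[F] V ⊗[F] V,
    ∀ z, z - s (z + τ z) ∈ Submodule.span F {w | ∃ v : V, w = v ⊗ₜ[F] v}

variable {i : V →ₗ[F] A} {Q : Prop} {τ : V ⊗[F] V →ₗ[F] V ⊗[F] V}

/-- The product of `A` on `V ⊗ V` factors through `id + τ` if squares vanish. -/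
lemma IsSkewBraiding.exists_factor (hτ : IsSkewBraiding τ) (hsq : ∀ v, i v * i v = 0) :
    ∃ ν : V ⊗[F] V →ₗ[F] A, LinearMap.mul' F A ∘ₗ TensorProduct.map i i =
      ν ∘ₗ (LinearMap.id + τ) := by
  obtain ⟨s, hs⟩ := hτ.factor
  refine ⟨LinearMap.mul' F A ∘ₗ TensorProduct.map i i ∘ₗ s, ?_⟩
  have hker : Submodule.span F {w | ∃ v : V, w = v ⊗ₜ[F] v} ≤
      LinearMap.ker (LinearMap.mul' F A ∘ₗ TensorProduct.map i i) := by
    rw [Submodule.span_le]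
    rintro _ ⟨v, rfl⟩
    simp [hsq]
  ext1
  ext v w
  have := hker (hs (v ⊗ₜ w))
  rw [LinearMap.mem_ker, map_sub, sub_eq_zero] at this
  simpa using this

/-- The extension of `c₀` to a crossing of `V` with `A`; for the exterior algebra, `h₀` says that
the operators which are extended to `A` have square zero. -/
lemma exists_crossing_of_gen (hA : IsPresented i Q) (c₀ : V ⊗[F] V →ₗ[F] V ⊗[F] A)
    (h₀ : Q → ∀ v w, slide c₀ v (c₀ (v ⊗ₜ w)) = 0) :
    ∃ c : A ⊗[F] V →ₗ[F] V ⊗[F] A, IsCrossing c ∧ ∀ v w, c (i v ⊗ₜ w) = c₀ (v ⊗ₜ w) := by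
  obtain ⟨g, hg⟩ := hA.lift (Module.End F (V ⊗[F] A)) (slide c₀) (fun hQ v => by
    ext w : 3
    simp [Module.End.mul_apply, slide_rmul, h₀ hQ])
  let c : A ⊗[F] V →ₗ[F] V ⊗[F] A := TensorProduct.lift
    (LinearMap.mk₂ F (fun a w => g a (w ⊗ₜ 1)) (by intros; simp) (by intros; simp)
      (by intros; simp [TensorProduct.add_tmul]) (by intros; simp [← TensorProduct.smul_tmul']))
  have hc : ∀ a w, c (a ⊗ₜ w) = g a (w ⊗ₜ 1) := fun a w => by simp [c]
  have hr : ∀ a y z, g a (rmul V y z) = rmul V y (g a z) := by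
    refine mem_of_adjoin_eq_top hA.adjoin (by simp) ?_ ?_ ?_ ?_
    · intro v y z
      rw [hg, slide_rmul]
    · intro x y hx hy t z
      simp [hx, hy]
    · intro r x hx t z
      simp [hx]
    · intro x y hx hy t z
      simp [hx, hy]
  have hs : ∀ a z, g a z = slide c a z := by
    intro a z
    induction z using TensorProduct.induction_on with
    | zero => simp only [map_zero]
    | add _ _ h₁ h₂ => simp only [map_add, h₁, h₂]
    | tmul w y => rw [slide_tmul, hc, ← hr, rmul_tmul, one_mul]
  refine ⟨c, ⟨fun w => by simp [hc], fun w a b => ?_⟩, fun v w => ?_⟩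
  · rw [hc, hc, ← hs, map_mul, Module.End.mul_apply]
  · rw [hc, hg, slide_tmul, rmul_one]

lemma slide_lTensor_eq (v : V) (t : V ⊗[F] V) :
    slide (i.lTensor V ∘ₗ τ) v (i.lTensor V t) =
      (LinearMap.mul' F A ∘ₗ TensorProduct.map i i).lTensor V (braid₁₂ V τ (v ⊗ₜ t)) := by
  induction t using TensorProduct.induction_on with
  | zero => simp only [map_zero, TensorProduct.tmul_zero]
  | add _ _ h₁ h₂ => simp only [map_add, TensorProduct.tmul_add, h₁, h₂]
  | tmul w x =>
    simp only [LinearMap.lTensor_tmul, slide_tmul, LinearMap.comp_apply, braid₁₂,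
      LinearEquiv.coe_coe, TensorProduct.assoc_symm_tmul, LinearMap.rTensor_tmul]
    generalize τ (v ⊗ₜ w) = s
    induction s using TensorProduct.induction_on with
    | zero => simp only [map_zero, TensorProduct.zero_tmul]
    | add _ _ h₁ h₂ => simp only [map_add, TensorProduct.add_tmul, h₁, h₂]
    | tmul a b => simp

/-- The braiding `τ` extends to a crossing of `V` with `A`. -/
lemma exists_crossing (hA : IsPresented i Q) (hτ : IsSkewBraiding τ) :
    ∃ c : A ⊗[F] V →ₗ[F] V ⊗[F] A, IsCrossing c ∧
      ∀ v w, c (i v ⊗ₜ w) = i.lTensor V (τ (v ⊗ₜ w)) := by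
  refine exists_crossing_of_gen hA (i.lTensor V ∘ₗ τ) fun hQ v w => ?_
  obtain ⟨ν, hν⟩ := hτ.exists_factor (hA.sq hQ)
  rw [LinearMap.comp_apply, slide_lTensor_eq, hν]
  have h1 : braid₁₂ V τ (v ⊗ₜ (v ⊗ₜ w)) = -(v ⊗ₜ (v ⊗ₜ w)) := by
    simp [braid₁₂, hτ.sq, TensorProduct.neg_tmul]
  have h2 := LinearMap.congr_fun hτ.yangBaxter (v ⊗ₜ (v ⊗ₜ w))
  simp only [LinearMap.comp_apply, h1, map_neg] at h2
  have h3 : v ⊗ₜ τ (v ⊗ₜ w) = braid₂₃ τ (v ⊗ₜ (v ⊗ₜ w)) := rfl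
  rw [h3, LinearMap.lTensor_comp_apply, LinearMap.lTensor_add, LinearMap.lTensor_id,
    LinearMap.add_apply, LinearMap.id_apply]
  change ν.lTensor V (_ + braid₂₃ τ (braid₁₂ V τ (braid₂₃ τ (v ⊗ₜ (v ⊗ₜ w))))) = 0
  rw [← h2, add_neg_cancel, map_zero]

/-- The defining properties of the braiding `β` of `A` with restriction `τ` to `V`; `c` is the
corestriction of `β` on `A ⊗ V`. -/
structure IsInducedBraiding (i : V →ₗ[F] A) (τ : V ⊗[F] V →ₗ[F] V ⊗[F] V)
    (c : A ⊗[F] V →ₗ[F] V ⊗[F] A) (β : A ⊗[F] A →ₗ[F] A ⊗[F] A) : Prop where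
  crossing : IsCrossing c
  crossing_gen : ∀ v w, c (i v ⊗ₜ w) = i.lTensor V (τ (v ⊗ₜ w))
  isCrossing : IsCrossing β
  tmul_one : ∀ x, β (x ⊗ₜ 1) = 1 ⊗ₜ x
  tmul_mul : ∀ a x y, β (a ⊗ₜ (x * y)) = slideR β y (β (a ⊗ₜ x))
  tmul_gen : ∀ w, NatAt c β i w

/-- `τ` commutes with the crossing of `V ⊗ V`. -/
lemma natAt_braiding_gen (hA : IsPresented i Q) (hτ : IsSkewBraiding τ)
    {c : A ⊗[F] V →ₗ[F] V ⊗[F] A} (hc : IsCrossing c)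
    (hcg : ∀ v w, c (i v ⊗ₜ w) = i.lTensor V (τ (v ⊗ₜ w))) (z : V ⊗[F] V) :
    NatAt (crossTensor c c) (crossTensor c c) τ z := by
  have key : ∀ v z, crossTensor c c (i v ⊗ₜ z) = i.lTensor (V ⊗[F] V)
      ((TensorProduct.assoc F V V V).symm (braid₂₃ τ (braid₁₂ V τ (v ⊗ₜ z)))) := by
    intro v z
    induction z using TensorProduct.induction_on with
    | zero => simp only [map_zero, TensorProduct.tmul_zero]
    | add _ _ h₁ h₂ => simp only [map_add, TensorProduct.tmul_add, h₁, h₂]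
    | tmul x y =>
      rw [crossTensor_tmul, hcg]
      simp only [braid₁₂, LinearMap.comp_apply,
        LinearEquiv.coe_coe, TensorProduct.assoc_symm_tmul, LinearMap.rTensor_tmul]
      generalize τ (v ⊗ₜ x) = s
      induction s using TensorProduct.induction_on with
      | zero => simp only [map_zero, TensorProduct.zero_tmul]
      | add _ _ h₁ h₂ => simp only [map_add, TensorProduct.add_tmul, h₁, h₂]
      | tmul a b =>
        simp only [LinearMap.lTensor_tmul, crossTail_tmul, hcg, braid₂₃, TensorProduct.assoc_tmul,
          assoc_symm_tmul_eq]
        rw [← LinearMap.comp_apply, LinearMap.rTensor_comp_lTensor,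
          ← LinearMap.lTensor_comp_rTensor, LinearMap.comp_apply]
  refine natAt_of_gen hA.adjoin (hc.crossTensor hc) (hc.crossTensor hc) (fun v z => ?_) z
  have h2 := LinearMap.congr_fun hτ.yangBaxter (v ⊗ₜ z)
  simp only [LinearMap.comp_apply] at h2
  have h3 : v ⊗ₜ τ z = braid₂₃ τ (v ⊗ₜ z) := rfl
  rw [key, key, h3, ← h2]
  generalize braid₂₃ τ (braid₁₂ V τ (v ⊗ₜ z)) = t
  rw [← LinearMap.comp_apply, LinearMap.rTensor_comp_lTensor, ← LinearMap.lTensor_comp_rTensor,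
    LinearMap.comp_apply]
  simp [braid₁₂]

/-- The map `A ⊗ A → A ⊗ A`, `x ⊗ b ↦ x G(b)`. -/
def mulExtend (G : A →ₗ[F] A ⊗[F] A) : A ⊗[F] A →ₗ[F] A ⊗[F] A :=
  (LinearMap.mul' F A).rTensor A ∘ₗ (TensorProduct.assoc F A A A).symm.toLinearMap ∘ₗ G.lTensor A

@[simp] lemma mulExtend_tmul (G : A →ₗ[F] A ⊗[F] A) (x b : A) :
    mulExtend G (x ⊗ₜ b) = lmul A x (G b) := by
  simp only [mulExtend, LinearMap.comp_apply, LinearMap.lTensor_tmul, LinearEquiv.coe_coe,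
    assoc_symm_tmul_eq, ← LinearMap.rTensor_comp_apply]
  rfl

lemma mulExtend_lmul (G : A →ₗ[F] A ⊗[F] A) (x : A) (z : A ⊗[F] A) :
    mulExtend G (lmul A x z) = lmul A x (mulExtend G z) := by
  induction z using TensorProduct.induction_on with
  | zero => simp only [map_zero]
  | add _ _ h₁ h₂ => simp only [map_add, h₁, h₂]
  | tmul a b => simp [lmul_lmul]

lemma mulExtend_add (G G' : A →ₗ[F] A ⊗[F] A) :
    mulExtend (G + G') = mulExtend G + mulExtend G' := by
  simp [mulExtend, LinearMap.lTensor_add, LinearMap.comp_add]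

lemma mulExtend_smul (r : F) (G : A →ₗ[F] A ⊗[F] A) :
    mulExtend (r • G) = r • mulExtend G := by
  simp [mulExtend, LinearMap.lTensor_smul, LinearMap.comp_smul]

/-- The braiding `τ` induces a braiding of `A`: the crossing of `V` with `A` is extended to words in
the second factor. -/
theorem exists_inducedBraiding (hA : IsPresented i Q) (hτ : IsSkewBraiding τ) :
    ∃ c β, IsInducedBraiding i τ c β := by
  obtain ⟨c, hc, hcg⟩ := exists_crossing hA hτ
  -- `P v` sends `G` to the map `a ↦ x G(b)`, where `x ⊗ b = c (a ⊗ v)`: it turns the map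
  -- `β (- ⊗ y)` into `β (- ⊗ vy)`.
  let P : V →ₗ[F] Module.End F (A →ₗ[F] A ⊗[F] A) :=
    LinearMap.mk₂ F (fun v G => mulExtend G ∘ₗ i.rTensor A ∘ₗ c ∘ₗ (TensorProduct.mk F A V).flip v)
      (fun v w G => LinearMap.ext fun a => by
        change mulExtend G (i.rTensor A (c (a ⊗ₜ (v + w)))) =
          mulExtend G (i.rTensor A (c (a ⊗ₜ v))) + mulExtend G (i.rTensor A (c (a ⊗ₜ w)))
        simp only [TensorProduct.tmul_add, map_add])
      (fun r v G => LinearMap.ext fun a => by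
        change mulExtend G (i.rTensor A (c (a ⊗ₜ (r • v)))) =
          r • mulExtend G (i.rTensor A (c (a ⊗ₜ v)))
        simp only [TensorProduct.tmul_smul, map_smul])
      (by intros; ext; simp [mulExtend_add]) (by intros; ext; simp [mulExtend_smul])
  have hP : ∀ v G a, P v G a = mulExtend G (i.rTensor A (c (a ⊗ₜ v))) := fun v G a => rfl
  have hP2 : Q → ∀ v, P v * P v = 0 := by
    intro hQ v
    obtain ⟨ν, hν⟩ := hτ.exists_factor (hA.sq hQ)
    ext1 G
    ext1 a
    have h1 : P v (P v G) a = mulExtend G ((LinearMap.mul' F A ∘ₗ TensorProduct.map i i).rTensor A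
        (crossTensor c c (a ⊗ₜ (v ⊗ₜ v)))) := by
      rw [hP, crossTensor_tmul]
      generalize c (a ⊗ₜ v) = z
      induction z using TensorProduct.induction_on with
      | zero => simp only [map_zero]
      | add _ _ h₁ h₂ => simp only [map_add, h₁, h₂]
      | tmul w b =>
        rw [LinearMap.rTensor_tmul, mulExtend_tmul, hP, crossTail_tmul]
        generalize c (b ⊗ₜ v) = z
        induction z using TensorProduct.induction_on with
        | zero => simp only [map_zero]
        | add _ _ h₁ h₂ => simp only [map_add, h₁, h₂]
        | tmul w b => simp [lmul_lmul]
    rw [Module.End.mul_apply, h1, hν, LinearMap.rTensor_comp_apply, LinearMap.rTensor_add,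
      LinearMap.rTensor_id, LinearMap.add_apply, LinearMap.id_apply,
      natAt_braiding_gen hA hτ hc hcg, hτ.sq]
    simp [TensorProduct.tmul_neg]
  obtain ⟨g, hg⟩ := hA.lift (Module.End F (A →ₗ[F] A ⊗[F] A)) P hP2
  let β : A ⊗[F] A →ₗ[F] A ⊗[F] A := TensorProduct.lift
    (LinearMap.mk₂ F (fun a x => g x (TensorProduct.mk F A A 1) a) (by intros; simp)
      (by intros; simp) (by intros; simp) (by intros; simp))
  have hβ : ∀ a x, β (a ⊗ₜ x) = g x (TensorProduct.mk F A A 1) a := fun a x => by simp [β]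
  have tmul_one : ∀ a, β (a ⊗ₜ 1) = 1 ⊗ₜ a := by
    intro a
    simp [hβ]
  have hE : ∀ x G a, g x G a = mulExtend G (β (a ⊗ₜ x)) := by
    refine mem_of_adjoin_eq_top hA.adjoin ?_ ?_ ?_ ?_ ?_
    · intro G a
      simp [tmul_one, lmul_one]
    · intro v G a
      rw [hβ, hg, hP, hP]
      congr 1
      generalize i.rTensor A (c (a ⊗ₜ v)) = z
      induction z using TensorProduct.induction_on with
      | zero => simp only [map_zero]
      | add _ _ h₁ h₂ => simp only [map_add, ← h₁, ← h₂]
      | tmul w b => simp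
    · intro x y hx hy G a
      simp [hx, hy, TensorProduct.tmul_add]
    · intro r x hx G a
      simp [hx]
    · intro x y hx hy G a
      rw [map_mul, Module.End.mul_apply, hx, hβ a (x * y), map_mul, Module.End.mul_apply, hx]
      generalize β (a ⊗ₜ x) = z
      induction z using TensorProduct.induction_on with
      | zero => simp only [map_zero]
      | add _ _ h₁ h₂ => simp only [map_add, h₁, h₂]
      | tmul w b => rw [mulExtend_tmul, mulExtend_tmul, mulExtend_lmul, hy, hβ]
  have tmul_mul : ∀ a x y, β (a ⊗ₜ (x * y)) = slideR β y (β (a ⊗ₜ x)) := by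
    intro a x y
    rw [hβ, map_mul, Module.End.mul_apply, hE]
    generalize β (a ⊗ₜ x) = z
    induction z using TensorProduct.induction_on with
    | zero => simp only [map_zero]
    | add _ _ h₁ h₂ => simp only [map_add, h₁, h₂]
    | tmul w b => rw [mulExtend_tmul, slideR_tmul, hβ]
  have tmul_gen : ∀ w, NatAt c β i w := by
    intro w a
    rw [hβ, hg, hP]
    generalize i.rTensor A (c (a ⊗ₜ w)) = z
    induction z using TensorProduct.induction_on with
    | zero => simp only [map_zero]
    | add _ _ h₁ h₂ => simp only [map_add, ← h₁, ← h₂]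
    | tmul w b => simp
  have hmul : ∀ w, NatAt (crossTensor β β) β (LinearMap.mul' F A) w := by
    refine fun w => natAt_of_forall_tmul (fun x y a => ?_) w
    rw [crossTensor_tmul, LinearMap.mul'_apply, tmul_mul]
    generalize β (a ⊗ₜ x) = z
    induction z using TensorProduct.induction_on with
    | zero => simp only [map_zero]
    | add _ _ h₁ h₂ => simp only [map_add, h₁, h₂]
    | tmul w b =>
      rw [crossTail_tmul, slideR_tmul, ← LinearMap.rTensor_comp_apply]
      rfl
  refine ⟨c, β, hc, hcg, ⟨?_, ?_⟩, tmul_one, tmul_mul, tmul_gen⟩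
  · refine mem_of_adjoin_eq_top hA.adjoin (tmul_one 1) ?_ ?_ ?_ ?_
    · intro v
      rw [← tmul_gen, hc.one, LinearMap.rTensor_tmul]
    · intro x y hx hy
      rw [TensorProduct.tmul_add, map_add, hx, hy, TensorProduct.add_tmul]
    · intro r x hx
      rw [TensorProduct.tmul_smul, map_smul, hx, TensorProduct.smul_tmul']
    · intro x y hx hy
      rw [tmul_mul, hx, slideR_tmul, hy, lmul_tmul]
  · refine mem_of_adjoin_eq_top hA.adjoin ?_ ?_ ?_ ?_ ?_
    · intro a b
      rw [tmul_one, tmul_one, slide_tmul, tmul_one, rmul_tmul]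
    · exact fun v => NatAt.crossMulAt tmul_gen (hc.mul v)
    · intro x y hx hy a b
      simp only [TensorProduct.tmul_add, map_add, hx a b, hy a b]
    · intro r x hx a b
      simp only [TensorProduct.tmul_smul, map_smul, hx a b]
    · exact fun x y hx hy => NatAt.crossMulAt hmul (hx.crossTensor hy)

end Braiding

/-! ### Invertibility and the Yang–Baxter equation -/

section YangBaxter

universe u v

variable {F : Type u} [Field F] {V : Type v} [AddCommGroup V] [Module F V]
  {A : Type (max u v)} [Ring A] [Algebra F A]
variable {i : V →ₗ[F] A} {Q : Prop} {τ τ' : V ⊗[F] V →ₗ[F] V ⊗[F] V}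
  {c c' : A ⊗[F] V →ₗ[F] V ⊗[F] A} {β β' : A ⊗[F] A →ₗ[F] A ⊗[F] A}

section Inverse

variable {W : Type*} [AddCommGroup W] [Module F W] {σ σ' : W ⊗[F] W →ₗ[F] W ⊗[F] W}

lemma braid₁₂_apply_of_inverse (h : σ ∘ₗ σ' = LinearMap.id) (z : W ⊗[F] (W ⊗[F] W)) :
    braid₁₂ W σ (braid₁₂ W σ' z) = z := by
  simp only [braid₁₂, LinearMap.comp_apply, LinearEquiv.coe_coe, LinearEquiv.symm_apply_apply,
    ← LinearMap.rTensor_comp_apply, h, LinearMap.rTensor_id, LinearMap.id_apply,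
    LinearEquiv.apply_symm_apply]

lemma braid₂₃_apply_of_inverse (h : σ ∘ₗ σ' = LinearMap.id) (z : W ⊗[F] (W ⊗[F] W)) :
    braid₂₃ σ (braid₂₃ σ' z) = z := by
  rw [braid₂₃, braid₂₃, ← LinearMap.lTensor_comp_apply, h, LinearMap.lTensor_id,
    LinearMap.id_apply]

end Inverse

/-- The inverse of a skew braiding is one: `id + τ'` is `τ' (id + τ)`, so `s τ` takes the place of
`s`. -/
lemma IsSkewBraiding.inverse (hτ : IsSkewBraiding τ) (h : τ ∘ₗ τ' = LinearMap.id)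
    (h' : τ' ∘ₗ τ = LinearMap.id) : IsSkewBraiding τ' where
  yangBaxter := by
    refine LinearMap.ext fun z => ?_
    obtain ⟨s, rfl⟩ : ∃ s, braid₁₂ V τ (braid₂₃ τ (braid₁₂ V τ s)) = z :=
      ⟨braid₁₂ V τ' (braid₂₃ τ' (braid₁₂ V τ' z)), by
        rw [braid₁₂_apply_of_inverse h, braid₂₃_apply_of_inverse h, braid₁₂_apply_of_inverse h]⟩
    have hY := LinearMap.congr_fun hτ.yangBaxter s
    simp only [LinearMap.comp_apply] at hY ⊢
    rw [braid₁₂_apply_of_inverse h', braid₂₃_apply_of_inverse h', braid₁₂_apply_of_inverse h', hY,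
      braid₂₃_apply_of_inverse h', braid₁₂_apply_of_inverse h', braid₂₃_apply_of_inverse h']
  sq v := by
    have := LinearMap.congr_fun h' (v ⊗ₜ v)
    rw [LinearMap.comp_apply, hτ.sq, map_neg, LinearMap.id_apply] at this
    rw [← this, neg_neg, this]
  factor := by
    obtain ⟨s, hs⟩ := hτ.factor
    refine ⟨s ∘ₗ τ, fun z => ?_⟩
    rw [LinearMap.comp_apply, map_add, ← LinearMap.comp_apply τ τ', h, LinearMap.id_apply, add_comm]
    exact hs z

lemma crossTensor_self_apply (β : A ⊗[F] A →ₗ[F] A ⊗[F] A) (z : A ⊗[F] (A ⊗[F] A)) :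
    TensorProduct.assoc F A A A (crossTensor β β z) = braid₂₃ β (braid₁₂ A β z) := by
  simp only [crossTensor, LinearMap.comp_apply, LinearEquiv.coe_coe, LinearEquiv.apply_symm_apply]
  rfl

lemma assoc_rTensor_apply (β : A ⊗[F] A →ₗ[F] A ⊗[F] A) (z : (A ⊗[F] A) ⊗[F] A) :
    TensorProduct.assoc F A A A (β.rTensor A z) =
      braid₁₂ A β (TensorProduct.assoc F A A A z) := by
  simp [braid₁₂]

/-- For `γ = β`, this is the Yang–Baxter equation for `β`. -/
lemma natAt_self_iff (γ β : A ⊗[F] A →ₗ[F] A ⊗[F] A) (z : A ⊗[F] A) :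
    NatAt (crossTensor γ γ) (crossTensor γ γ) β z ↔
      ∀ a, braid₁₂ A β (braid₂₃ γ (braid₁₂ A γ (a ⊗ₜ z))) =
        braid₂₃ γ (braid₁₂ A γ (braid₂₃ β (a ⊗ₜ z))) := by
  refine forall_congr' fun a => ?_
  rw [← (TensorProduct.assoc F A A A).injective.eq_iff, assoc_rTensor_apply,
    crossTensor_self_apply, crossTensor_self_apply]
  rfl

lemma IsInducedBraiding.restrict (hβ : IsInducedBraiding i τ c β) :
    β ∘ₗ TensorProduct.map i i = TensorProduct.map i i ∘ₗ τ := by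
  ext v w
  simp only [TensorProduct.AlgebraTensorModule.curry_apply, LinearMap.restrictScalars_self,
    TensorProduct.curry_apply, LinearMap.comp_apply, TensorProduct.map_tmul]
  rw [← hβ.tmul_gen, hβ.crossing_gen, ← LinearMap.comp_apply, LinearMap.rTensor_comp_lTensor]

lemma IsInducedBraiding.one_tmul (hβ : IsInducedBraiding i τ c β) (x : A) :
    β (1 ⊗ₜ x) = x ⊗ₜ 1 :=
  hβ.isCrossing.one x

lemma IsInducedBraiding.mul_tmul (hβ : IsInducedBraiding i τ c β) (x y z : A) :
    β ((x * y) ⊗ₜ z) = slide β x (β (y ⊗ₜ z)) :=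
  hβ.isCrossing.mul z x y

lemma IsInducedBraiding.slide_mul (hβ : IsInducedBraiding i τ c β) (x y : A) (z : A ⊗[F] A) :
    slide β (x * y) z = slide β x (slide β y z) := by
  induction z using TensorProduct.induction_on with
  | zero => simp only [map_zero]
  | add _ _ h₁ h₂ => simp only [map_add, h₁, h₂]
  | tmul a b => rw [slide_tmul, hβ.mul_tmul, slide_tmul, slide_rmul]

lemma rTensor_mul_crossTail (β : A ⊗[F] A →ₗ[F] A ⊗[F] A) (y : A) (z : A ⊗[F] A) :
    (LinearMap.mul' F A).rTensor A (crossTail A β y z) = slideR β y z := by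
  induction z using TensorProduct.induction_on with
  | zero => simp only [map_zero]
  | add _ _ h₁ h₂ => simp only [map_add, h₁, h₂]
  | tmul w b =>
    rw [crossTail_tmul, slideR_tmul, ← LinearMap.rTensor_comp_apply]
    rfl

/-- The product of `A` commutes with the braiding. -/
lemma IsInducedBraiding.natAt_mul (hβ : IsInducedBraiding i τ c β) (z : A ⊗[F] A) :
    NatAt (crossTensor β β) β (LinearMap.mul' F A) z := by
  refine natAt_of_forall_tmul (fun x y a => ?_) z
  rw [crossTensor_tmul, LinearMap.mul'_apply, hβ.tmul_mul, rTensor_mul_crossTail]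

lemma IsInducedBraiding.apply_rmul (hβ : IsInducedBraiding i τ c β) (y : A) (z : A ⊗[F] A) :
    β (rmul A y z) = slideR β y (β z) := by
  induction z using TensorProduct.induction_on with
  | zero => simp only [map_zero]
  | add _ _ h₁ h₂ => simp only [map_add, h₁, h₂]
  | tmul a b => rw [rmul_tmul, hβ.tmul_mul]

lemma IsInducedBraiding.apply_lmul (hβ : IsInducedBraiding i τ c β) (x : A) (z : A ⊗[F] A) :
    β (lmul A x z) = slide β x (β z) := by
  induction z using TensorProduct.induction_on with
  | zero => simp only [map_zero]
  | add _ _ h₁ h₂ => simp only [map_add, h₁, h₂]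
  | tmul a b => rw [lmul_tmul, hβ.mul_tmul]

/-- An inverse of `τ` induces an inverse of the braiding induced by `τ`. -/
theorem IsInducedBraiding.inverse (hA : IsPresented i Q) (hβ : IsInducedBraiding i τ c β)
    (hβ' : IsInducedBraiding i τ' c' β') (hτ : τ' ∘ₗ τ = LinearMap.id) :
    β' ∘ₗ β = LinearMap.id := by
  have hgen : ∀ x w, β' (β (x ⊗ₜ i w)) = x ⊗ₜ i w := by
    refine mem_of_adjoin_eq_top hA.adjoin ?_ ?_ ?_ ?_ ?_
    · intro w
      rw [hβ.one_tmul, hβ'.tmul_one]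
    · intro v w
      have := LinearMap.congr_fun hβ.restrict (v ⊗ₜ w)
      simp only [LinearMap.comp_apply, TensorProduct.map_tmul] at this
      rw [this, ← LinearMap.comp_apply, hβ'.restrict, LinearMap.comp_apply,
        ← LinearMap.comp_apply τ', hτ]
      rfl
    · intro x y hx hy w
      simp only [TensorProduct.add_tmul, map_add, hx, hy]
    · intro r x hx w
      simp only [← TensorProduct.smul_tmul', map_smul, hx]
    · intro x y hx hy w
      rw [hβ.mul_tmul]
      have key : β' (slide β x (β (y ⊗ₜ i w))) = lmul A x (β' (β (y ⊗ₜ i w))) := by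
        rw [← hβ.tmul_gen]
        generalize c (y ⊗ₜ w) = z
        induction z using TensorProduct.induction_on with
        | zero => simp only [map_zero]
        | add _ _ h₁ h₂ => simp only [map_add, h₁, h₂]
        | tmul u t =>
          rw [LinearMap.rTensor_tmul, slide_tmul, hβ'.apply_rmul, hx, slideR_tmul]
      rw [key, hy, lmul_tmul]
  suffices h : ∀ y x, β' (β (x ⊗ₜ y)) = x ⊗ₜ y from TensorProduct.ext' fun x y => h y x
  refine mem_of_adjoin_eq_top hA.adjoin ?_ ?_ ?_ ?_ ?_
  · intro x
    rw [hβ.tmul_one, hβ'.one_tmul]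
  · exact fun w x => hgen x w
  · intro x y hx hy w
    simp only [TensorProduct.tmul_add, map_add, hx, hy]
  · intro r x hx w
    simp only [TensorProduct.tmul_smul, map_smul, hx]
  · intro y₁ y₂ h₁ h₂ x
    rw [hβ.tmul_mul]
    have key : ∀ z, β' (slideR β y₂ z) = rmul A y₂ (β' z) := by
      intro z
      induction z using TensorProduct.induction_on with
      | zero => simp only [map_zero]
      | add _ _ h₁ h₂ => simp only [map_add, h₁, h₂]
      | tmul s t => rw [slideR_tmul, hβ'.apply_lmul, h₂, slide_tmul]
    rw [key, h₁, rmul_tmul]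

lemma IsInducedBraiding.mul_left (hβ : IsInducedBraiding i τ c β) :
    β ∘ₗ (LinearMap.mul' F A).rTensor A ∘ₗ (TensorProduct.assoc F A A A).symm.toLinearMap =
      (LinearMap.mul' F A).lTensor A ∘ₗ braid₁₂ A β ∘ₗ braid₂₃ β := by
  refine TensorProduct.ext_threefold' fun x y z => ?_
  simp only [LinearMap.comp_apply, LinearEquiv.coe_coe, TensorProduct.assoc_symm_tmul,
    LinearMap.rTensor_tmul, LinearMap.mul'_apply, hβ.mul_tmul, braid₂₃, LinearMap.lTensor_tmul,
    braid₁₂]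
  generalize β (y ⊗ₜ z) = w
  induction w using TensorProduct.induction_on with
  | zero => simp only [map_zero, TensorProduct.tmul_zero]
  | add _ _ h₁ h₂ => simp only [map_add, TensorProduct.tmul_add, h₁, h₂]
  | tmul s t =>
    rw [slide_tmul, TensorProduct.assoc_symm_tmul, LinearMap.rTensor_tmul, assoc_tmul_eq,
      ← LinearMap.lTensor_comp_apply]
    rfl

lemma IsInducedBraiding.mul_right (hβ : IsInducedBraiding i τ c β) :
    β ∘ₗ (LinearMap.mul' F A).lTensor A =
      (LinearMap.mul' F A).rTensor A ∘ₗ (TensorProduct.assoc F A A A).symm.toLinearMap ∘ₗ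
        braid₂₃ β ∘ₗ braid₁₂ A β := by
  refine TensorProduct.ext' fun x z => ?_
  exact (hβ.natAt_mul z x).symm

/-- The braiding commutes with itself. -/
theorem IsInducedBraiding.natAt_self (hA : IsPresented i Q) (hτ : IsSkewBraiding τ)
    (hβ : IsInducedBraiding i τ c β) (z : A ⊗[F] A) :
    NatAt (crossTensor β β) (crossTensor β β) β z := by
  have hone : ∀ y, NatAt (crossTensor β β) (crossTensor β β) β (1 ⊗ₜ y) := by
    intro y a
    rw [crossTensor_tmul, hβ.tmul_one, crossTail_tmul, hβ.one_tmul, crossTensor_tmul]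
    generalize β (a ⊗ₜ y) = z
    induction z using TensorProduct.induction_on with
    | zero => simp only [map_zero]
    | add _ _ h₁ h₂ => simp only [map_add, h₁, h₂]
    | tmul s t => simp [hβ.one_tmul, hβ.tmul_one]
  have hone' : ∀ x, NatAt (crossTensor β β) (crossTensor β β) β (x ⊗ₜ 1) := by
    intro x a
    rw [crossTensor_tmul, hβ.tmul_one, crossTensor_tmul, hβ.tmul_one, crossTail_tmul]
    generalize β (a ⊗ₜ x) = z
    induction z using TensorProduct.induction_on with
    | zero => simp only [map_zero]
    | add _ _ h₁ h₂ => simp only [map_add, h₁, h₂]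
    | tmul s t => simp [hβ.tmul_one]
  have hgen : ∀ x w, NatAt (crossTensor β β) (crossTensor β β) β (x ⊗ₜ i w) := by
    refine mem_of_adjoin_eq_top hA.adjoin (fun w => hone _) ?_ ?_ ?_ ?_
    · intro v w
      refine NatAt.of_comp (f := TensorProduct.map i i) (c := crossTensor c c) (w := v ⊗ₜ w) ?_
        (natAt_map hβ.tmul_gen hβ.tmul_gen _)
      rw [hβ.restrict]
      exact NatAt.comp (natAt_map hβ.tmul_gen hβ.tmul_gen _)
        (natAt_braiding_gen hA hτ hβ.crossing hβ.crossing_gen _)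
    · intro x y hx hy w
      rw [TensorProduct.add_tmul]
      exact (hx w).add (hy w)
    · intro r x hx w
      rw [← TensorProduct.smul_tmul']
      exact (hx w).smul r
    · intro x y hx hy w
      refine NatAt.of_comp (c := crossTensor β (crossTensor β β))
        (f := (LinearMap.mul' F A).rTensor A ∘ₗ (TensorProduct.assoc F A A A).symm.toLinearMap)
        (w := x ⊗ₜ (y ⊗ₜ i w)) ?_
        (NatAt.comp (natAt_map hβ.natAt_mul natAt_id _) (natAt_assoc_symm _))
      rw [hβ.mul_left]
      refine NatAt.comp (c' := crossTensor β (crossTensor β β))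
        (natAt_map natAt_id hβ.natAt_mul _) (NatAt.comp (c' := crossTensor β (crossTensor β β)) ?_
          (NatAt.map (natAt_id _) (hy w)))
      refine NatAt.comp (natAt_assoc _) (NatAt.comp (c' := crossTensor (crossTensor β β) β) ?_
        (natAt_assoc_symm _))
      change NatAt _ _ _ ((TensorProduct.assoc F A A A).symm (x ⊗ₜ β (y ⊗ₜ i w)))
      rw [← hβ.tmul_gen]
      generalize c (y ⊗ₜ w) = z
      induction z using TensorProduct.induction_on with
      | zero => simpa using NatAt.zero _
      | add _ _ h₁ h₂ =>
        simp only [map_add, TensorProduct.tmul_add]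
        exact h₁.add h₂
      | tmul s t => exact NatAt.map (hx s) (natAt_id _)
  -- The second factor is reduced to a generator before the first (`hgen`), because `β` is known to
  -- map `A ⊗ V`, rather than `V ⊗ A`, to tensors with a factor in `V`.
  suffices h : ∀ y x, NatAt (crossTensor β β) (crossTensor β β) β (x ⊗ₜ y) from
    natAt_of_forall_tmul (fun x y => h y x) z
  refine mem_of_adjoin_eq_top hA.adjoin hone' (fun w x => hgen x w) ?_ ?_ ?_
  · intro x y hx hy w
    rw [TensorProduct.tmul_add]
    exact (hx w).add (hy w)
  · intro r x hx w
    rw [TensorProduct.tmul_smul]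
    exact (hx w).smul r
  · intro y₁ y₂ h₁ h₂ x
    refine NatAt.of_comp (c := crossTensor β (crossTensor β β))
      (f := (LinearMap.mul' F A).lTensor A) (w := x ⊗ₜ (y₁ ⊗ₜ y₂)) ?_
      (natAt_map natAt_id hβ.natAt_mul _)
    rw [hβ.mul_right]
    refine NatAt.comp (c' := crossTensor (crossTensor β β) β)
      (natAt_map hβ.natAt_mul natAt_id _) (NatAt.comp (c' := crossTensor β (crossTensor β β))
        (natAt_assoc_symm _) (NatAt.comp (c' := crossTensor β (crossTensor β β)) ?_
          (NatAt.comp (natAt_assoc _) (NatAt.comp (c' := crossTensor (crossTensor β β) β)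
            (NatAt.map (h₁ x) (natAt_id y₂)) (natAt_assoc_symm _)))))
    change NatAt _ _ (β.lTensor A) (TensorProduct.assoc F A A A (β (x ⊗ₜ y₁) ⊗ₜ y₂))
    generalize β (x ⊗ₜ y₁) = z
    induction z using TensorProduct.induction_on with
    | zero => simpa using NatAt.zero _
    | add _ _ h₁ h₂ =>
      simp only [map_add, TensorProduct.add_tmul]
      exact h₁.add h₂
    | tmul s t => exact NatAt.map (natAt_id _) (h₂ t)

theorem IsInducedBraiding.yangBaxter (hA : IsPresented i Q) (hτ : IsSkewBraiding τ)
    (hβ : IsInducedBraiding i τ c β) :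
    braid₁₂ A β ∘ₗ braid₂₃ β ∘ₗ braid₁₂ A β = braid₂₃ β ∘ₗ braid₁₂ A β ∘ₗ braid₂₃ β :=
  TensorProduct.ext' fun a z => (natAt_self_iff β β z).mp (hβ.natAt_self hA hτ z) a

/-- The braiding commutes with the crossings given by its inverse. -/
lemma natAt_of_inverse
    (hY : braid₁₂ A β ∘ₗ braid₂₃ β ∘ₗ braid₁₂ A β = braid₂₃ β ∘ₗ braid₁₂ A β ∘ₗ braid₂₃ β)
    (h : β ∘ₗ β' = LinearMap.id) (h' : β' ∘ₗ β = LinearMap.id) (z : A ⊗[F] A) :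
    NatAt (crossTensor β' β') (crossTensor β' β') β z := by
  rw [natAt_self_iff]
  intro a
  generalize a ⊗ₜ[F] z = t
  -- Write `t` as the image of `s` under `β₁₂ β₂₃`.
  obtain ⟨s, rfl⟩ : ∃ s, braid₁₂ A β (braid₂₃ β s) = t :=
    ⟨braid₂₃ β' (braid₁₂ A β' t), by
      rw [braid₂₃_apply_of_inverse h, braid₁₂_apply_of_inverse h]⟩
  have hY' := LinearMap.congr_fun hY s
  simp only [LinearMap.comp_apply] at hY'
  rw [← hY', braid₁₂_apply_of_inverse h', braid₂₃_apply_of_inverse h',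
    braid₁₂_apply_of_inverse h', braid₂₃_apply_of_inverse h']

end YangBaxter

/-! ### Coproduct, antipode and their compatibility with the braiding -/

section Structure

universe u v

variable {F : Type u} [Field F] {V : Type v} [AddCommGroup V] [Module F V]
  {A : Type (max u v)} [Ring A] [Algebra F A]
variable {i : V →ₗ[F] A} {Q : Prop} {τ τ' : V ⊗[F] V →ₗ[F] V ⊗[F] V}
  {c c' : A ⊗[F] V →ₗ[F] V ⊗[F] A} {β β' γ : A ⊗[F] A →ₗ[F] A ⊗[F] A}

/-- The product of the braided tensor square `A ⊗ A`. -/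
def braidedMul (β : A ⊗[F] A →ₗ[F] A ⊗[F] A) : (A ⊗[F] A) ⊗[F] (A ⊗[F] A) →ₗ[F] A ⊗[F] A :=
  TensorProduct.map (LinearMap.mul' F A) (LinearMap.mul' F A) ∘ₗ braidMiddle β

lemma braidedMul_tmul (β : A ⊗[F] A →ₗ[F] A ⊗[F] A) (x y z t : A) :
    braidedMul β ((x ⊗ₜ y) ⊗ₜ (z ⊗ₜ t)) = lmul A x (rmul A t (β (y ⊗ₜ z))) := by
  simp only [braidedMul, braidMiddle, braid₁₂, LinearMap.comp_apply, LinearEquiv.coe_coe,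
    TensorProduct.assoc_tmul, LinearMap.lTensor_tmul, TensorProduct.assoc_symm_tmul,
    LinearMap.rTensor_tmul]
  generalize β (y ⊗ₜ z) = w
  induction w using TensorProduct.induction_on with
  | zero => simp only [map_zero, TensorProduct.tmul_zero, TensorProduct.zero_tmul]
  | add _ _ h₁ h₂ => simp only [map_add, TensorProduct.tmul_add, TensorProduct.add_tmul, h₁, h₂]
  | tmul s r => simp

lemma lmul_add (x y : A) (z : A ⊗[F] A) : lmul A (x + y) z = lmul A x z + lmul A y z := by
  rw [lmul, show LinearMap.mulLeft F (x + y) = LinearMap.mulLeft F x + LinearMap.mulLeft F y by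
    ext; simp [add_mul], LinearMap.rTensor_add, LinearMap.add_apply]
  rfl

lemma lmul_smul (r : F) (x : A) (z : A ⊗[F] A) : lmul A (r • x) z = r • lmul A x z := by
  rw [lmul, show LinearMap.mulLeft F (r • x) = r • LinearMap.mulLeft F x by
    ext; simp, LinearMap.rTensor_smul, LinearMap.smul_apply]
  rfl

/-- Left multiplication by the primitive element `i v ⊗ 1 + 1 ⊗ i v` in the braided tensor
square. -/
def primMul (i : V →ₗ[F] A) (β : A ⊗[F] A →ₗ[F] A ⊗[F] A) : V →ₗ[F] Module.End F (A ⊗[F] A) :=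
  LinearMap.mk₂ F (fun v z => lmul A (i v) z + slide β (i v) z)
    (by intro v w z; rw [map_add, map_add, lmul_add, LinearMap.add_apply]; abel)
    (by intro r v z; rw [map_smul, map_smul, lmul_smul, LinearMap.smul_apply, smul_add])
    (by intro v w z; simp only [map_add]; abel)
    (by intro r v z; simp only [map_smul, smul_add])

lemma primMul_apply (v : V) (z : A ⊗[F] A) :
    primMul i β v z = lmul A (i v) z + slide β (i v) z := rfl

lemma slide_lmul (hβ : IsInducedBraiding i τ c β) (a x : A) (z : A ⊗[F] A) :
    slide β a (lmul A x z) = mulExtend ((slide β).flip z) (β (a ⊗ₜ x)) := by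
  induction z using TensorProduct.induction_on with
  | zero =>
    simp only [map_zero]
    simp [mulExtend]
  | add _ _ h₁ h₂ => simp only [map_add, h₁, h₂, mulExtend_add, LinearMap.add_apply]
  | tmul y t =>
    rw [lmul_tmul, slide_tmul, hβ.tmul_mul]
    generalize β (a ⊗ₜ x) = w
    induction w using TensorProduct.induction_on with
    | zero => simp only [map_zero]
    | add _ _ h₁ h₂ => simp only [map_add, h₁, h₂]
    | tmul p q =>
      rw [slideR_tmul, mulExtend_tmul, LinearMap.flip_apply, slide_tmul, lmul_rmul]

/-- Associativity of the braided tensor square, for a primitive first factor. -/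
lemma primMul_braidedMul (hβ : IsInducedBraiding i τ c β) (v : V) (X Y : A ⊗[F] A) :
    primMul i β v (braidedMul β (X ⊗ₜ Y)) = braidedMul β (primMul i β v X ⊗ₜ Y) := by
  induction X using TensorProduct.induction_on with
  | zero => simp only [map_zero, TensorProduct.zero_tmul]
  | add _ _ h₁ h₂ => simp only [map_add, TensorProduct.add_tmul, h₁, h₂]
  | tmul x y =>
    induction Y using TensorProduct.induction_on with
    | zero => simp only [map_zero, TensorProduct.tmul_zero]
    | add _ _ h₁ h₂ => simp only [map_add, TensorProduct.tmul_add, h₁, h₂]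
    | tmul z t =>
      rw [braidedMul_tmul, primMul_apply, primMul_apply, TensorProduct.add_tmul, map_add, lmul_lmul,
        lmul_tmul, braidedMul_tmul, lmul_rmul x t, slide_rmul, slide_lmul hβ, slide_tmul]
      congr 1
      generalize β (i v ⊗ₜ x) = w
      induction w using TensorProduct.induction_on with
      | zero => simp only [map_zero, TensorProduct.zero_tmul]
      | add _ _ h₁ h₂ => simp only [map_add, TensorProduct.add_tmul, h₁, h₂]
      | tmul p q =>
        rw [mulExtend_tmul, LinearMap.flip_apply, rmul_tmul, braidedMul_tmul, hβ.mul_tmul,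
          lmul_rmul]

/-- In the exterior algebra, the primitive element `v ⊗ 1 + 1 ⊗ v` of the braided tensor square has
square zero: the mixed terms cancel since `τ (v ⊗ v) = -v ⊗ v`. -/
lemma primMul_mul_self (hA : IsPresented i Q) (hτ : IsSkewBraiding τ)
    (hβ : IsInducedBraiding i τ c β) (hQ : Q) (v : V) :
    primMul i β v * primMul i β v = 0 := by
  have hl : ∀ z : A ⊗[F] A, lmul A (i v) (lmul A (i v) z) = 0 := by
    intro z
    rw [lmul_lmul, hA.sq hQ]
    simp [lmul]
  have hs : ∀ z, slide β (i v) (slide β (i v) z) = 0 := by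
    intro z
    rw [← hβ.slide_mul, hA.sq hQ v, map_zero, LinearMap.zero_apply]
  have hls : ∀ z, slide β (i v) (lmul A (i v) z) = -lmul A (i v) (slide β (i v) z) := by
    intro z
    have h := LinearMap.congr_fun hβ.restrict (v ⊗ₜ v)
    simp only [LinearMap.comp_apply, TensorProduct.map_tmul, hτ.sq, map_neg] at h
    rw [slide_lmul hβ, h, map_neg, mulExtend_tmul, LinearMap.flip_apply]
  refine LinearMap.ext fun z => ?_
  rw [Module.End.mul_apply, primMul_apply, primMul_apply, map_add, map_add, hl, hs, hls]
  simp

/-- The coproduct of `A`, for which the generators are primitive. -/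
theorem exists_comul (hA : IsPresented i Q) (hτ : IsSkewBraiding τ)
    (hβ : IsInducedBraiding i τ c β) :
    ∃ Δ : A →ₗ[F] A ⊗[F] A, Δ 1 = 1 ⊗ₜ 1 ∧ ∀ v x, Δ (i v * x) = primMul i β v (Δ x) := by
  obtain ⟨g, hg⟩ := hA.lift (Module.End F (A ⊗[F] A)) (primMul i β)
    (primMul_mul_self hA hτ hβ)
  refine ⟨LinearMap.applyₗ (1 ⊗ₜ[F] 1 : A ⊗[F] A) ∘ₗ g.toLinearMap, by simp, fun v x => ?_⟩
  simp [hg]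

/-- The counit, the coproduct and the antipode of `A`, given by their values on the unit and by
recursion on words in the generators. -/
structure IsHopfData (i : V →ₗ[F] A) (β : A ⊗[F] A →ₗ[F] A ⊗[F] A) (Δ : A →ₗ[F] A ⊗[F] A)
    (ε : A →ₐ[F] F) (S : A →ₗ[F] A) : Prop where
  comul_one : Δ 1 = 1 ⊗ₜ 1
  comul_gen_mul : ∀ v x, Δ (i v * x) = primMul i β v (Δ x)
  counit_gen : ∀ v, ε (i v) = 0
  antipode_one : S 1 = 1
  antipode_gen_mul : ∀ v x, S (i v * x) = -LinearMap.mul' F A (β (i v ⊗ₜ S x))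

/-- The product `∇ β` of `A`, opposite with respect to the braiding, is associative. -/
lemma mul'_braiding_assoc (hA : IsPresented i Q) (hτ : IsSkewBraiding τ)
    (hβ : IsInducedBraiding i τ c β) (x y z : A) :
    LinearMap.mul' F A (β (x ⊗ₜ LinearMap.mul' F A (β (y ⊗ₜ z)))) =
      LinearMap.mul' F A (β (LinearMap.mul' F A (β (x ⊗ₜ y)) ⊗ₜ z)) := by
  have hl := LinearMap.congr_fun hβ.mul_left (TensorProduct.assoc F A A A (β (x ⊗ₜ y) ⊗ₜ z))
  have hr := LinearMap.congr_fun hβ.mul_right (x ⊗ₜ β (y ⊗ₜ z))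
  have hY := LinearMap.congr_fun (hβ.yangBaxter hA hτ) (x ⊗ₜ (y ⊗ₜ z))
  have h12 : TensorProduct.assoc F A A A (β (x ⊗ₜ y) ⊗ₜ z) =
    braid₁₂ A β (x ⊗ₜ (y ⊗ₜ z)) := rfl
  have h23 : x ⊗ₜ β (y ⊗ₜ z) = braid₂₃ β (x ⊗ₜ (y ⊗ₜ z)) := rfl
  simp only [LinearMap.comp_apply, LinearEquiv.coe_coe, LinearEquiv.symm_apply_apply,
    LinearMap.rTensor_tmul, LinearMap.lTensor_tmul] at hl hr hY
  rw [hl, hr, h12, h23, hY]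
  generalize braid₂₃ β (braid₁₂ A β (braid₂₃ β (x ⊗ₜ[F] (y ⊗ₜ[F] z)))) = w
  have key : LinearMap.mul' F A ∘ₗ (LinearMap.mul' F A).rTensor A ∘ₗ
      (TensorProduct.assoc F A A A).symm.toLinearMap =
      LinearMap.mul' F A ∘ₗ (LinearMap.mul' F A).lTensor A :=
    TensorProduct.ext_threefold' fun x y z => by simp [mul_assoc]
  exact LinearMap.congr_fun key w

/-- The antipode of `A`. -/
theorem exists_antipode (hA : IsPresented i Q) (hτ : IsSkewBraiding τ)
    (hβ : IsInducedBraiding i τ c β) :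
    ∃ S : A →ₗ[F] A, S 1 = 1 ∧ ∀ v x, S (i v * x) = -LinearMap.mul' F A (β (i v ⊗ₜ S x)) := by
  let K : V →ₗ[F] Module.End F A :=
    LinearMap.mk₂ F (fun v y => -LinearMap.mul' F A (β (i v ⊗ₜ y)))
      (by intros; simp only [map_add, TensorProduct.add_tmul, neg_add])
      (by intros; simp only [map_smul, ← TensorProduct.smul_tmul', smul_neg])
      (by intros; simp only [map_add, TensorProduct.tmul_add, neg_add])
      (by intros; simp only [map_smul, TensorProduct.tmul_smul, smul_neg])
  have hK : ∀ v y, K v y = -LinearMap.mul' F A (β (i v ⊗ₜ y)) := fun v y => rfl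
  obtain ⟨g, hg⟩ := hA.lift (Module.End F A) K (fun hQ v => by
    refine LinearMap.ext fun y => ?_
    have h := LinearMap.congr_fun hβ.restrict (v ⊗ₜ v)
    simp only [LinearMap.comp_apply, TensorProduct.map_tmul, hτ.sq, map_neg] at h
    rw [Module.End.mul_apply, hK, hK, TensorProduct.tmul_neg, map_neg, map_neg, neg_neg,
      mul'_braiding_assoc hA hτ hβ, h]
    simp [hA.sq hQ])
  refine ⟨LinearMap.applyₗ (1 : A) ∘ₗ g.toLinearMap, by simp, fun v x => ?_⟩
  simp [hg, hK]

section Nat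

variable {Δ : A →ₗ[F] A ⊗[F] A} {ε : A →ₐ[F] F} {S : A →ₗ[F] A}

lemma braidedMul_one_tmul (hβ : IsInducedBraiding i τ c β) (Y : A ⊗[F] A) :
    braidedMul β ((1 ⊗ₜ 1) ⊗ₜ Y) = Y := by
  induction Y using TensorProduct.induction_on with
  | zero => simp only [map_zero, TensorProduct.tmul_zero]
  | add _ _ h₁ h₂ => simp only [map_add, TensorProduct.tmul_add, h₁, h₂]
  | tmul z t => simp [braidedMul_tmul, hβ.one_tmul]

lemma IsHopfData.comul_mul (hA : IsPresented i Q) (hβ : IsInducedBraiding i τ c β)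
    (h : IsHopfData i β Δ ε S) :
    braidedMul β ∘ₗ TensorProduct.map Δ Δ = Δ ∘ₗ LinearMap.mul' F A := by
  suffices h : ∀ x y, braidedMul β (Δ x ⊗ₜ Δ y) = Δ (x * y) from TensorProduct.ext' h
  refine mem_of_gen_mul hA.adjoin ?_ ?_ ?_ ?_
  · intro y
    rw [h.comul_one, braidedMul_one_tmul hβ, one_mul]
  · intro x y hx hy z
    rw [map_add, TensorProduct.add_tmul, map_add, hx, hy, add_mul, map_add]
  · intro r x hx z
    rw [map_smul, ← TensorProduct.smul_tmul', map_smul, hx, smul_mul_assoc, map_smul]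
  · intro v x hx y
    rw [h.comul_gen_mul, ← primMul_braidedMul hβ, hx, mul_assoc, h.comul_gen_mul]

lemma IsHopfData.comul_gen (hβ : IsInducedBraiding i τ c β) (h : IsHopfData i β Δ ε S) (v : V) :
    Δ (i v) = i v ⊗ₜ 1 + 1 ⊗ₜ i v := by
  have := h.comul_gen_mul v 1
  simpa [primMul_apply, h.comul_one, hβ.tmul_one] using this

lemma IsHopfData.antipode_gen (hβ : IsInducedBraiding i τ c β) (h : IsHopfData i β Δ ε S) (v : V) :
    S (i v) = -i v := by
  have := h.antipode_gen_mul v 1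
  simpa [h.antipode_one, hβ.tmul_one] using this

/-- The antipode is an antihomomorphism with respect to the braiding. -/
lemma IsHopfData.antipode_mul (hA : IsPresented i Q) (hτ : IsSkewBraiding τ)
    (hβ : IsInducedBraiding i τ c β) (h : IsHopfData i β Δ ε S) :
    S ∘ₗ LinearMap.mul' F A = LinearMap.mul' F A ∘ₗ β ∘ₗ TensorProduct.map S S := by
  suffices h : ∀ x y, S (x * y) = LinearMap.mul' F A (β (S x ⊗ₜ S y)) from TensorProduct.ext' h
  refine mem_of_gen_mul hA.adjoin ?_ ?_ ?_ ?_
  · intro y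
    simp [h.antipode_one, hβ.one_tmul]
  · intro x y hx hy z
    rw [map_add, TensorProduct.add_tmul, map_add, map_add, ← hx, ← hy, add_mul, map_add]
  · intro r x hx z
    rw [map_smul, ← TensorProduct.smul_tmul', map_smul, map_smul, ← hx, smul_mul_assoc, map_smul]
  · intro v x hx y
    rw [mul_assoc, h.antipode_gen_mul, hx, h.antipode_gen_mul, mul'_braiding_assoc hA hτ hβ,
      TensorProduct.neg_tmul, map_neg, map_neg]

lemma natAt_of_adjoin {W : Type*} [AddCommGroup W] [Module F W] (hA : IsPresented i Q)
    {d : A ⊗[F] W →ₗ[F] W ⊗[F] A} {f : A →ₗ[F] W} (one : NatAt γ d f 1)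
    (gen : ∀ v, NatAt γ d f (i v)) (mul : ∀ x y, NatAt γ d f x → NatAt γ d f y →
      NatAt γ d f (x * y)) (x : A) : NatAt γ d f x :=
  mem_of_adjoin_eq_top hA.adjoin one gen (fun _ _ hx hy => hx.add hy) (fun r _ hx => hx.smul r)
    mul x

/-- The coproduct commutes with every induced braiding with which `β` commutes. -/
lemma IsHopfData.natAt_comul (hA : IsPresented i Q) (hβ : IsInducedBraiding i τ c β)
    (h : IsHopfData i β Δ ε S) (hγ : IsInducedBraiding i τ' c' γ)
    (hβγ : ∀ z, NatAt (crossTensor γ γ) (crossTensor γ γ) β z) (x : A) :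
    NatAt γ (crossTensor γ γ) Δ x := by
  refine natAt_of_adjoin hA ?_ ?_ ?_ x
  · intro a
    simp [h.comul_one, hγ.tmul_one, crossTensor_tmul]
  · intro v a
    rw [h.comul_gen hβ, TensorProduct.tmul_add, map_add, crossTensor_tmul, crossTensor_tmul,
      hγ.tmul_one, ← hγ.tmul_gen, crossTail_tmul, ← hγ.tmul_gen]
    generalize c' (a ⊗ₜ v) = z
    induction z using TensorProduct.induction_on with
    | zero => simp only [map_zero, add_zero]
    | add _ _ h₁ h₂ => simp only [map_add, h₁, h₂]; abel
    | tmul w b => simp [h.comul_gen hβ, hγ.tmul_one, TensorProduct.add_tmul]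
  · intro x y hx hy
    refine NatAt.of_comp (c := crossTensor γ γ) (f := LinearMap.mul' F A) (w := x ⊗ₜ y) ?_
      (hγ.natAt_mul _)
    rw [← h.comul_mul hA hβ]
    -- `Δ ∇` is composed of `Δ ⊗ Δ`, `β` in the middle, and `∇ ⊗ ∇`, all of which commute with `γ`.
    refine NatAt.comp (c' := crossTensor (crossTensor γ γ) (crossTensor γ γ)) ?_ (hx.map hy)
    refine NatAt.comp (c' := crossTensor (crossTensor γ γ) (crossTensor γ γ))
      (natAt_map hγ.natAt_mul hγ.natAt_mul _) ?_
    refine NatAt.comp (c' := crossTensor γ (crossTensor γ (crossTensor γ γ)))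
      (natAt_assoc_symm _) (NatAt.comp (c' := crossTensor γ (crossTensor γ (crossTensor γ γ))) ?_
        (natAt_assoc _))
    refine natAt_map natAt_id (fun z => ?_) _
    exact NatAt.comp (c' := crossTensor (crossTensor γ γ) γ) (natAt_assoc _)
      (NatAt.comp (c' := crossTensor (crossTensor γ γ) γ) (natAt_map hβγ natAt_id _)
        (natAt_assoc_symm _))

/-- The antipode commutes with every induced braiding with which `β` commutes. -/
lemma IsHopfData.natAt_antipode (hA : IsPresented i Q) (hτ : IsSkewBraiding τ)
    (hβ : IsInducedBraiding i τ c β)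
    (h : IsHopfData i β Δ ε S) (hγ : IsInducedBraiding i τ' c' γ)
    (hβγ : ∀ z, NatAt (crossTensor γ γ) (crossTensor γ γ) β z) (x : A) :
    NatAt γ γ S x := by
  refine natAt_of_adjoin hA ?_ ?_ ?_ x
  · intro a
    simp [h.antipode_one, hγ.tmul_one]
  · intro v a
    rw [h.antipode_gen hβ, TensorProduct.tmul_neg, map_neg, ← hγ.tmul_gen]
    generalize c' (a ⊗ₜ v) = z
    induction z using TensorProduct.induction_on with
    | zero => simp only [map_zero, neg_zero]
    | add _ _ h₁ h₂ => simp only [map_add, h₁, h₂, neg_add]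
    | tmul w b => simp [h.antipode_gen hβ, TensorProduct.neg_tmul]
  · intro x y hx hy
    refine NatAt.of_comp (c := crossTensor γ γ) (f := LinearMap.mul' F A) (w := x ⊗ₜ y) ?_
      (hγ.natAt_mul _)
    rw [h.antipode_mul hA hτ hβ]
    exact NatAt.comp (hγ.natAt_mul _) (NatAt.comp (hβγ _) (hx.map hy))

/-- The counit commutes with every induced braiding. -/
lemma IsHopfData.counit_braiding (hA : IsPresented i Q)
    (h : IsHopfData i β Δ ε S) (hγ : IsInducedBraiding i τ' c' γ) (x a : A) :
    TensorProduct.lid F A (ε.toLinearMap.rTensor A (γ (a ⊗ₜ x))) = ε x • a := by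
  revert a
  revert x
  refine mem_of_adjoin_eq_top hA.adjoin ?_ ?_ ?_ ?_ ?_
  · intro a
    simp [hγ.tmul_one]
  · intro v a
    rw [← hγ.tmul_gen, ← LinearMap.rTensor_comp_apply,
      show ε.toLinearMap ∘ₗ i = 0 from LinearMap.ext h.counit_gen, h.counit_gen]
    simp
  · intro x y hx hy a
    simp only [TensorProduct.tmul_add, map_add, hx, hy, add_smul]
  · intro r x hx a
    simp only [TensorProduct.tmul_smul, map_smul, hx, smul_assoc]
  · intro x y hx hy a
    rw [hγ.tmul_mul, map_mul, mul_comm, mul_smul, ← hx, ← map_smul]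
    generalize γ (a ⊗ₜ x) = z
    induction z using TensorProduct.induction_on with
    | zero => simp only [map_zero, smul_zero]
    | add _ _ h₁ h₂ => simp only [map_add, h₁, h₂, smul_add]
    | tmul w b =>
      have : ∀ t, TensorProduct.lid F A (ε.toLinearMap.rTensor A (lmul A w t)) =
          ε w • TensorProduct.lid F A (ε.toLinearMap.rTensor A t) := by
        intro t
        induction t using TensorProduct.induction_on with
        | zero => simp only [map_zero, smul_zero]
        | add _ _ h₁ h₂ => simp only [map_add, h₁, h₂, smul_add]
        | tmul p q => simp [mul_smul]
      rw [slideR_tmul, this, hy]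
      rw [LinearMap.rTensor_tmul, map_smul, TensorProduct.lid_tmul, smul_comm]
      rfl

end Nat

end Structure

/-! ### The Hopf axioms -/

section Axioms

universe u v

variable {F : Type u} [Field F] {V : Type v} [AddCommGroup V] [Module F V]
  {A : Type (max u v)} [Ring A] [Algebra F A]
variable {i : V →ₗ[F] A} {Q : Prop} {τ τ' : V ⊗[F] V →ₗ[F] V ⊗[F] V}
  {c c' : A ⊗[F] V →ₗ[F] V ⊗[F] A} {β β' γ : A ⊗[F] A →ₗ[F] A ⊗[F] A}
  {Δ : A →ₗ[F] A ⊗[F] A} {ε : A →ₐ[F] F} {S : A →ₗ[F] A}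

/-- The braiding commutes with `∇ ⊗ ∇`. -/
theorem IsInducedBraiding.fusion (hβ : IsInducedBraiding i τ c β) :
    β ∘ₗ TensorProduct.map (LinearMap.mul' F A) (LinearMap.mul' F A) =
      braidedMul β ∘ₗ TensorProduct.map β β ∘ₗ braidMiddle β := by
  ext x y z w
  simp only [TensorProduct.AlgebraTensorModule.curry_apply, LinearMap.restrictScalars_self,
    TensorProduct.curry_apply, LinearMap.comp_apply, TensorProduct.map_tmul, LinearMap.mul'_apply,
    hβ.mul_tmul, hβ.tmul_mul, braidMiddle, braid₁₂, LinearEquiv.coe_coe,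
    TensorProduct.assoc_tmul, LinearMap.lTensor_tmul, TensorProduct.assoc_symm_tmul,
    LinearMap.rTensor_tmul]
  generalize β (y ⊗ₜ z) = r
  induction r using TensorProduct.induction_on with
  | zero => simp only [map_zero, TensorProduct.tmul_zero, TensorProduct.zero_tmul]
  | add _ _ h₁ h₂ => simp only [map_add, TensorProduct.tmul_add, TensorProduct.add_tmul, h₁, h₂]
  | tmul z' y' =>
    simp only [slideR_tmul, slide_lmul hβ, TensorProduct.assoc_tmul, TensorProduct.assoc_symm_tmul,
      TensorProduct.map_tmul]
    generalize β (x ⊗ₜ z') = X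
    generalize β (y' ⊗ₜ w) = Y
    induction X using TensorProduct.induction_on with
    | zero => simp only [map_zero, TensorProduct.zero_tmul]
    | add _ _ h₁ h₂ => simp only [map_add, TensorProduct.add_tmul, h₁, h₂]
    | tmul z'' x' =>
      rw [mulExtend_tmul, LinearMap.flip_apply]
      induction Y using TensorProduct.induction_on with
      | zero => simp only [map_zero, TensorProduct.tmul_zero]
      | add _ _ h₁ h₂ => simp only [map_add, TensorProduct.tmul_add, h₁, h₂]
      | tmul w' y'' => rw [braidedMul_tmul, slide_tmul]

lemma IsHopfData.comul_braiding_left (hA : IsPresented i Q) (hτ : IsSkewBraiding τ)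
    (hβ : IsInducedBraiding i τ c β) (h : IsHopfData i β Δ ε S) :
    (TensorProduct.assoc F A A A).toLinearMap ∘ₗ Δ.rTensor A ∘ₗ β =
      braid₂₃ β ∘ₗ braid₁₂ A β ∘ₗ Δ.lTensor A := by
  refine TensorProduct.ext' fun a x => ?_
  have := h.natAt_comul hA hβ hβ (hβ.natAt_self hA hτ) x a
  simp only [LinearMap.comp_apply, this, LinearEquiv.coe_coe, LinearMap.lTensor_tmul]
  exact crossTensor_self_apply _ _

/-- The mirror image of `IsHopfData.comul_braiding_left`: it says that the coproduct commutes with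
the inverse braiding. -/
lemma IsHopfData.comul_braiding_right (hA : IsPresented i Q) (hτ : IsSkewBraiding τ)
    (hβ : IsInducedBraiding i τ c β) (h : IsHopfData i β Δ ε S)
    (hβ' : IsInducedBraiding i τ' c' β') (hββ' : β ∘ₗ β' = LinearMap.id)
    (hβ'β : β' ∘ₗ β = LinearMap.id) :
    Δ.lTensor A ∘ₗ β = braid₁₂ A β ∘ₗ braid₂₃ β ∘ₗ
      (TensorProduct.assoc F A A A).toLinearMap ∘ₗ Δ.rTensor A := by
  have key : ∀ w, TensorProduct.assoc F A A A (Δ.rTensor A (β' w)) =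
      braid₂₃ β' (braid₁₂ A β' (Δ.lTensor A w)) := by
    intro w
    induction w using TensorProduct.induction_on with
    | zero => simp only [map_zero]
    | add _ _ h₁ h₂ => simp only [map_add, h₁, h₂]
    | tmul a x =>
      rw [h.natAt_comul hA hβ hβ'
        (natAt_of_inverse (hβ.yangBaxter hA hτ) hββ' hβ'β) x a, crossTensor_self_apply,
        LinearMap.lTensor_tmul]
  refine LinearMap.ext fun z => ?_
  have h1 := key (β z)
  rw [← LinearMap.comp_apply β', hβ'β, LinearMap.id_apply] at h1
  simp only [LinearMap.comp_apply, LinearEquiv.coe_coe, h1]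
  rw [braid₂₃_apply_of_inverse hββ', braid₁₂_apply_of_inverse hββ']

lemma IsHopfData.braiding_antipode_left (hA : IsPresented i Q) (hτ : IsSkewBraiding τ)
    (hβ : IsInducedBraiding i τ c β) (h : IsHopfData i β Δ ε S)
    (hβ' : IsInducedBraiding i τ' c' β') (hββ' : β ∘ₗ β' = LinearMap.id)
    (hβ'β : β' ∘ₗ β = LinearMap.id) :
    β ∘ₗ S.rTensor A = S.lTensor A ∘ₗ β := by
  have key : ∀ w, S.rTensor A (β' w) = β' (S.lTensor A w) := by
    intro w
    induction w using TensorProduct.induction_on with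
    | zero => simp only [map_zero]
    | add _ _ h₁ h₂ => simp only [map_add, h₁, h₂]
    | tmul a x =>
      rw [h.natAt_antipode hA hτ hβ hβ'
        (natAt_of_inverse (hβ.yangBaxter hA hτ) hββ' hβ'β) x a, LinearMap.lTensor_tmul]
  refine LinearMap.ext fun z => ?_
  have h1 := key (β z)
  rw [← LinearMap.comp_apply β', hβ'β, LinearMap.id_apply] at h1
  rw [LinearMap.comp_apply, h1, ← LinearMap.comp_apply β, hββ']
  rfl

lemma IsHopfData.counit_braiding_right (hA : IsPresented i Q) (h : IsHopfData i β Δ ε S)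
    (hβ' : IsInducedBraiding i τ' c' β') (hβ'β : β' ∘ₗ β = LinearMap.id) :
    (TensorProduct.rid F A).toLinearMap ∘ₗ ε.toLinearMap.lTensor A ∘ₗ β =
      (TensorProduct.lid F A).toLinearMap ∘ₗ ε.toLinearMap.rTensor A := by
  have key : ∀ w, TensorProduct.lid F A (ε.toLinearMap.rTensor A (β' w)) =
      TensorProduct.rid F A (ε.toLinearMap.lTensor A w) := by
    intro w
    induction w using TensorProduct.induction_on with
    | zero => simp only [map_zero]
    | add _ _ h₁ h₂ => simp only [map_add, h₁, h₂]
    | tmul a x => rw [h.counit_braiding hA hβ']; simp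
  refine LinearMap.ext fun z => ?_
  have h1 := key (β z)
  rw [← LinearMap.comp_apply β', hβ'β, LinearMap.id_apply] at h1
  exact h1.symm

/-- The map `A ⊗ (A ⊗ A) → A ⊗ A`, `t ⊗ Y ↦ (t ⊗ 1 + 1 ⊗ t) Y`, for the product of the braided
tensor square. -/
def primAct (β : A ⊗[F] A →ₗ[F] A ⊗[F] A) : A ⊗[F] (A ⊗[F] A) →ₗ[F] A ⊗[F] A :=
  (LinearMap.mul' F A).rTensor A ∘ₗ (TensorProduct.assoc F A A A).symm.toLinearMap +
    TensorProduct.lift (slide β)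

lemma primAct_tmul (β : A ⊗[F] A →ₗ[F] A ⊗[F] A) (t : A) (Y : A ⊗[F] A) :
    primAct β (t ⊗ₜ Y) = lmul A t Y + slide β t Y := by
  simp only [primAct, LinearMap.add_apply, LinearMap.comp_apply, LinearEquiv.coe_coe,
    assoc_symm_tmul_eq, TensorProduct.lift.tmul, ← LinearMap.rTensor_comp_apply]
  rfl

/-- Left multiplication by `v ⊗ 1 ⊗ 1 + 1 ⊗ v ⊗ 1 + 1 ⊗ 1 ⊗ v`, for the product of the braided
tensor cube: the effect on both iterated coproducts of left multiplication by the generator `v`. -/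
def primMul₃ (i : V →ₗ[F] A) (β : A ⊗[F] A →ₗ[F] A ⊗[F] A) (v : V) :
    A ⊗[F] (A ⊗[F] A) →ₗ[F] A ⊗[F] (A ⊗[F] A) :=
  lmul (A ⊗[F] A) (i v) +
    (primAct β).lTensor A ∘ₗ braid₁₂ (A ⊗[F] A) β ∘ₗ TensorProduct.mk F A _ (i v)

lemma primMul₃_tmul (v : V) (x : A) (Y : A ⊗[F] A) :
    primMul₃ i β v (x ⊗ₜ Y) = (i v * x) ⊗ₜ Y +
      (primAct β).lTensor A (TensorProduct.assoc F A A _ (β (i v ⊗ₜ x) ⊗ₜ Y)) := by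
  simp [primMul₃, braid₁₂]

lemma IsHopfData.comul_rTensor_primMul (hA : IsPresented i Q) (hτ : IsSkewBraiding τ)
    (hβ : IsInducedBraiding i τ c β) (h : IsHopfData i β Δ ε S) (v : V) (z : A ⊗[F] A) :
    TensorProduct.assoc F A A A (Δ.rTensor A (primMul i β v z)) =
      primMul₃ i β v (TensorProduct.assoc F A A A (Δ.rTensor A z)) := by
  induction z using TensorProduct.induction_on with
  | zero => simp only [map_zero]
  | add _ _ h₁ h₂ => simp only [map_add, h₁, h₂]
  | tmul x y =>
    rw [primMul_apply, lmul_tmul, slide_tmul, map_add, rTensor_rmul,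
      h.natAt_comul hA hβ hβ (hβ.natAt_self hA hτ), LinearMap.rTensor_tmul, LinearMap.rTensor_tmul,
      h.comul_gen_mul]
    generalize Δ x = X
    induction X using TensorProduct.induction_on with
    | zero => simp only [map_zero, TensorProduct.tmul_zero, TensorProduct.zero_tmul, add_zero]
    | add _ _ h₁ h₂ =>
      simp only [map_add, TensorProduct.tmul_add, TensorProduct.add_tmul, ← h₁, ← h₂]
      abel
    | tmul p q =>
      rw [TensorProduct.assoc_tmul, primMul₃_tmul, primMul_apply, crossTensor_tmul, slide_tmul,
        TensorProduct.add_tmul, map_add, map_add, lmul_tmul, TensorProduct.assoc_tmul, add_assoc]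
      congr 1
      generalize β (i v ⊗ₜ p) = w
      induction w using TensorProduct.induction_on with
      | zero => simp only [map_zero, TensorProduct.zero_tmul, add_zero]
      | add _ _ h₁ h₂ =>
        simp only [map_add, TensorProduct.add_tmul, ← h₁, ← h₂]
        abel
      | tmul s t =>
        rw [rmul_tmul, crossTail_tmul, TensorProduct.assoc_tmul, TensorProduct.assoc_tmul,
          LinearMap.lTensor_tmul, primAct_tmul, lmul_tmul, slide_tmul, TensorProduct.tmul_add,
          ← rTensor_rmul, ← assoc_symm_tmul_eq, LinearEquiv.apply_symm_apply]

/-- The hypothesis `hr` moves `Δ` past the braiding `i v ⊗ x ↦ s ⊗ t`, as if `t` were primitive. -/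
lemma IsHopfData.comul_lTensor_primMul (hA : IsPresented i Q) (hβ : IsInducedBraiding i τ c β)
    (h : IsHopfData i β Δ ε S)
    (hr : Δ.lTensor A ∘ₗ β = braid₁₂ A β ∘ₗ braid₂₃ β ∘ₗ
      (TensorProduct.assoc F A A A).toLinearMap ∘ₗ Δ.rTensor A) (v : V) (z : A ⊗[F] A) :
    Δ.lTensor A (primMul i β v z) = primMul₃ i β v (Δ.lTensor A z) := by
  induction z using TensorProduct.induction_on with
  | zero => simp only [map_zero]
  | add _ _ h₁ h₂ => simp only [map_add, h₁, h₂]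
  | tmul x y =>
    rw [primMul_apply, lmul_tmul, slide_tmul, map_add, LinearMap.lTensor_tmul,
      LinearMap.lTensor_tmul, primMul₃_tmul]
    congr 1
    have hm : ∀ w, Δ.lTensor A (rmul A y w) = (braidedMul β ∘ₗ
        (TensorProduct.mk F (A ⊗[F] A) (A ⊗[F] A)).flip (Δ y)).lTensor A (Δ.lTensor A w) := by
      intro w
      induction w using TensorProduct.induction_on with
      | zero => simp only [map_zero]
      | add _ _ h₁ h₂ => simp only [map_add, h₁, h₂]
      | tmul s t =>
        have := LinearMap.congr_fun (h.comul_mul hA hβ) (t ⊗ₜ y)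
        simp only [LinearMap.comp_apply, TensorProduct.map_tmul, LinearMap.mul'_apply] at this
        simp [this]
    have h2 := LinearMap.congr_fun hr (i v ⊗ₜ x)
    simp only [LinearMap.comp_apply] at h2
    rw [hm, h2, LinearMap.rTensor_tmul, h.comul_gen hβ]
    simp only [TensorProduct.add_tmul, map_add, LinearEquiv.coe_coe, TensorProduct.assoc_tmul,
      braid₂₃, LinearMap.lTensor_tmul, hβ.one_tmul]
    simp only [braid₁₂, LinearMap.comp_apply, LinearEquiv.coe_coe, TensorProduct.assoc_symm_tmul,
      LinearMap.rTensor_tmul]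
    generalize β (i v ⊗ₜ x) = w
    induction w using TensorProduct.induction_on with
    | zero => simp only [map_zero, TensorProduct.zero_tmul, TensorProduct.tmul_zero, add_zero]
    | add _ _ h₁ h₂ =>
      simp only [map_add, TensorProduct.add_tmul, TensorProduct.tmul_add, ← h₁, ← h₂]
      abel
    | tmul s t =>
      simp only [TensorProduct.assoc_tmul, TensorProduct.assoc_symm_tmul, LinearMap.rTensor_tmul,
        hβ.one_tmul, LinearMap.lTensor_tmul, primAct_tmul, LinearMap.comp_apply,
        LinearMap.flip_apply, TensorProduct.mk_apply, ← TensorProduct.tmul_add]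
      congr 1
      generalize Δ y = Y
      induction Y using TensorProduct.induction_on with
      | zero => simp only [map_zero, TensorProduct.tmul_zero, add_zero]
      | add _ _ h₁ h₂ =>
        simp only [map_add, TensorProduct.tmul_add]
        rw [add_add_add_comm, h₁, h₂, add_add_add_comm]
      | tmul p q => simp [braidedMul_tmul, hβ.one_tmul, lmul_one]

theorem IsHopfData.coassoc (hA : IsPresented i Q) (hτ : IsSkewBraiding τ)
    (hβ : IsInducedBraiding i τ c β) (h : IsHopfData i β Δ ε S)
    (hr : Δ.lTensor A ∘ₗ β = braid₁₂ A β ∘ₗ braid₂₃ β ∘ₗ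
      (TensorProduct.assoc F A A A).toLinearMap ∘ₗ Δ.rTensor A) :
    (TensorProduct.assoc F A A A).toLinearMap ∘ₗ Δ.rTensor A ∘ₗ Δ = Δ.lTensor A ∘ₗ Δ := by
  refine LinearMap.ext (mem_of_gen_mul hA.adjoin ?_ ?_ ?_ ?_)
  · simp [h.comul_one]
  · intro x y hx hy
    rw [map_add, hx, hy, map_add]
  · intro r x hx
    rw [map_smul, hx, map_smul]
  · intro v x hx
    simp only [LinearMap.comp_apply, LinearEquiv.coe_coe] at hx ⊢
    rw [h.comul_gen_mul, h.comul_rTensor_primMul hA hτ hβ, hx,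
      h.comul_lTensor_primMul hA hβ hr]

theorem IsHopfData.counit_left (hA : IsPresented i Q) (hβ : IsInducedBraiding i τ c β)
    (h : IsHopfData i β Δ ε S) :
    (TensorProduct.lid F A).toLinearMap ∘ₗ ε.toLinearMap.rTensor A ∘ₗ Δ = LinearMap.id := by
  have key : ∀ v z, TensorProduct.lid F A (ε.toLinearMap.rTensor A (primMul i β v z)) =
      i v * TensorProduct.lid F A (ε.toLinearMap.rTensor A z) := by
    intro v z
    induction z using TensorProduct.induction_on with
    | zero => simp only [map_zero, mul_zero]
    | add _ _ h₁ h₂ => simp only [map_add, h₁, h₂, mul_add]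
    | tmul x y =>
      have hr : ∀ w : A ⊗[F] A, TensorProduct.lid F A (ε.toLinearMap.rTensor A (rmul A y w)) =
          TensorProduct.lid F A (ε.toLinearMap.rTensor A w) * y := by
        intro w
        induction w using TensorProduct.induction_on with
        | zero => simp only [map_zero, zero_mul]
        | add _ _ h₁ h₂ => simp only [map_add, h₁, h₂, add_mul]
        | tmul s t => simp
      rw [primMul_apply, slide_tmul, map_add, map_add, hr, h.counit_braiding hA hβ]
      simp [h.counit_gen]
  refine LinearMap.ext (mem_of_gen_mul hA.adjoin ?_ ?_ ?_ ?_)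
  · simp [h.comul_one]
  · intro x y hx hy
    rw [map_add, hx, hy, map_add]
  · intro r x hx
    rw [map_smul, hx, map_smul]
  · intro v x hx
    simp only [LinearMap.comp_apply, LinearEquiv.coe_coe, LinearMap.id_apply] at hx ⊢
    rw [h.comul_gen_mul, key, hx]

theorem IsHopfData.counit_right (hA : IsPresented i Q)
    (h : IsHopfData i β Δ ε S)
    (hr : (TensorProduct.rid F A).toLinearMap ∘ₗ ε.toLinearMap.lTensor A ∘ₗ β =
      (TensorProduct.lid F A).toLinearMap ∘ₗ ε.toLinearMap.rTensor A) :
    (TensorProduct.rid F A).toLinearMap ∘ₗ ε.toLinearMap.lTensor A ∘ₗ Δ = LinearMap.id := by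
  have key : ∀ v z, TensorProduct.rid F A (ε.toLinearMap.lTensor A (primMul i β v z)) =
      i v * TensorProduct.rid F A (ε.toLinearMap.lTensor A z) := by
    intro v z
    induction z using TensorProduct.induction_on with
    | zero => simp only [map_zero, mul_zero]
    | add _ _ h₁ h₂ => simp only [map_add, h₁, h₂, mul_add]
    | tmul x y =>
      have hs : ∀ w : A ⊗[F] A, TensorProduct.rid F A (ε.toLinearMap.lTensor A (rmul A y w)) =
          ε y • TensorProduct.rid F A (ε.toLinearMap.lTensor A w) := by
        intro w
        induction w using TensorProduct.induction_on with
        | zero => simp only [map_zero, smul_zero]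
        | add _ _ h₁ h₂ => simp only [map_add, h₁, h₂, smul_add]
        | tmul s t => simp [mul_smul, smul_comm (ε t)]
      have h2 := LinearMap.congr_fun hr (i v ⊗ₜ x)
      simp only [LinearMap.comp_apply, LinearEquiv.coe_coe] at h2
      rw [primMul_apply, slide_tmul, map_add, map_add, hs, h2]
      simp [h.counit_gen]
  refine LinearMap.ext (mem_of_gen_mul hA.adjoin ?_ ?_ ?_ ?_)
  · simp [h.comul_one]
  · intro x y hx hy
    rw [map_add, hx, hy, map_add]
  · intro r x hx
    rw [map_smul, hx, map_smul]
  · intro v x hx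
    simp only [LinearMap.comp_apply, LinearEquiv.coe_coe, LinearMap.id_apply] at hx ⊢
    rw [h.comul_gen_mul, key, hx]

theorem IsHopfData.antipode_left (hA : IsPresented i Q) (hτ : IsSkewBraiding τ)
    (hβ : IsInducedBraiding i τ c β) (h : IsHopfData i β Δ ε S) :
    LinearMap.mul' F A ∘ₗ S.rTensor A ∘ₗ Δ = Algebra.linearMap F A ∘ₗ ε.toLinearMap := by
  have key : ∀ v z, LinearMap.mul' F A (S.rTensor A (primMul i β v z)) = 0 := by
    intro v z
    induction z using TensorProduct.induction_on with
    | zero => simp only [map_zero]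
    | add _ _ h₁ h₂ => simp only [map_add, h₁, h₂, add_zero]
    | tmul x y =>
      have hr : ∀ w : A ⊗[F] A, LinearMap.mul' F A (rmul A y w) = LinearMap.mul' F A w * y := by
        intro w
        induction w using TensorProduct.induction_on with
        | zero => simp only [map_zero, zero_mul]
        | add _ _ h₁ h₂ => simp only [map_add, h₁, h₂, add_mul]
        | tmul s t => simp [mul_assoc]
      rw [primMul_apply, slide_tmul, map_add, map_add, rTensor_rmul, hr,
        h.natAt_antipode hA hτ hβ hβ (hβ.natAt_self hA hτ)]
      simp [h.antipode_gen_mul]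
  refine LinearMap.ext (mem_of_gen_mul hA.adjoin ?_ ?_ ?_ ?_)
  · simp [h.comul_one, h.antipode_one]
  · intro x y hx hy
    rw [map_add, hx, hy, map_add]
  · intro r x hx
    rw [map_smul, hx, map_smul]
  · intro v x hx
    simp only [LinearMap.comp_apply]
    rw [h.comul_gen_mul, key]
    simp [h.counit_gen]

theorem IsHopfData.antipode_right (hA : IsPresented i Q) (hτ : IsSkewBraiding τ)
    (hβ : IsInducedBraiding i τ c β) (h : IsHopfData i β Δ ε S)
    (hl : β ∘ₗ S.rTensor A = S.lTensor A ∘ₗ β) :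
    LinearMap.mul' F A ∘ₗ S.lTensor A ∘ₗ Δ = Algebra.linearMap F A ∘ₗ ε.toLinearMap := by
  -- For `z = Δ x` and `h = ∇ (id ⊗ S) Δ x`, a scalar by induction, the right-hand side vanishes.
  have key : ∀ v z, LinearMap.mul' F A (S.lTensor A (primMul i β v z)) =
      i v * LinearMap.mul' F A (S.lTensor A z) -
        LinearMap.mul' F A (β (i v ⊗ₜ LinearMap.mul' F A (S.lTensor A z))) := by
    intro v z
    induction z using TensorProduct.induction_on with
    | zero => simp only [map_zero, mul_zero, TensorProduct.tmul_zero, sub_zero]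
    | add _ _ h₁ h₂ =>
      simp only [map_add, h₁, h₂, mul_add, TensorProduct.tmul_add]
      abel
    | tmul x y =>
      have hr : ∀ w : A ⊗[F] A, LinearMap.mul' F A (S.lTensor A (rmul A y w)) =
          LinearMap.mul' F A (slideR β (S y) (S.lTensor A w)) := by
        intro w
        induction w using TensorProduct.induction_on with
        | zero => simp only [map_zero]
        | add _ _ h₁ h₂ => simp only [map_add, h₁, h₂]
        | tmul s t =>
          have h2 := LinearMap.congr_fun (h.antipode_mul hA hτ hβ) (t ⊗ₜ y)
          simp only [LinearMap.comp_apply, TensorProduct.map_tmul, LinearMap.mul'_apply] at h2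
          rw [rmul_tmul, LinearMap.lTensor_tmul, LinearMap.lTensor_tmul, slideR_tmul, h2,
            LinearMap.mul'_apply]
          generalize β (S t ⊗ₜ S y) = w
          induction w using TensorProduct.induction_on with
          | zero => simp only [map_zero, mul_zero]
          | add _ _ h₁ h₂ => simp only [map_add, ← h₁, ← h₂, mul_add]
          | tmul p q => simp [mul_assoc]
      have h2 := LinearMap.congr_fun hl (i v ⊗ₜ x)
      simp only [LinearMap.comp_apply, LinearMap.rTensor_tmul, h.antipode_gen hβ,
        TensorProduct.neg_tmul, map_neg] at h2
      rw [primMul_apply, slide_tmul, map_add, map_add, hr, ← h2, map_neg, map_neg, ← hβ.tmul_mul]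
      simp [mul_assoc, sub_eq_add_neg]
  refine LinearMap.ext (mem_of_gen_mul hA.adjoin ?_ ?_ ?_ ?_)
  · simp [h.comul_one, h.antipode_one]
  · intro x y hx hy
    rw [map_add, hx, hy, map_add]
  · intro r x hx
    rw [map_smul, hx, map_smul]
  · intro v x hx
    simp only [LinearMap.comp_apply] at hx ⊢
    rw [h.comul_gen_mul, key, hx]
    simp [h.counit_gen, Algebra.algebraMap_eq_smul_one, hβ.tmul_one]

/-- A presented algebra is a braided Hopf algebra for the braiding induced by `τ`. -/
theorem exists_braidedHopfStructure (hA : IsPresented i Q) (ε : A →ₐ[F] F) (hε : ∀ v, ε (i v) = 0)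
    (hτ : IsSkewBraiding τ) (hτ' : IsSkewBraiding τ') (h : τ ∘ₗ τ' = LinearMap.id)
    (h' : τ' ∘ₗ τ = LinearMap.id) :
    ∃ (T : BraidedHopfStructure F A) (c : A ⊗[F] V →ₗ[F] V ⊗[F] A),
      IsInducedBraiding i τ c T.braiding ∧ IsHopfData i T.braiding T.comul ε T.antipode ∧
        T.counit = ε.toLinearMap := by
  obtain ⟨c, β, hβ⟩ := exists_inducedBraiding hA hτ
  obtain ⟨c', β', hβ'⟩ := exists_inducedBraiding hA hτ'
  obtain ⟨Δ, hΔ1, hΔ⟩ := exists_comul hA hτ hβ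
  obtain ⟨S, hS1, hS⟩ := exists_antipode hA hτ hβ
  have hH : IsHopfData i β Δ ε S := ⟨hΔ1, hΔ, hε, hS1, hS⟩
  have hβ'β := hβ.inverse hA hβ' h'
  have hββ' := hβ'.inverse hA hβ h
  have hcr := hH.comul_braiding_right hA hτ hβ hβ' hββ' hβ'β
  have hεr := hH.counit_braiding_right hA hβ' hβ'β
  have hSl := hH.braiding_antipode_left hA hτ hβ hβ' hββ' hβ'β
  exact ⟨{
    braiding := β
    comul := Δ
    counit := ε.toLinearMap
    antipode := S
    isBraided := {
      bijective := Function.bijective_iff_has_inverse.mpr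
        ⟨β', LinearMap.congr_fun hβ'β, LinearMap.congr_fun hββ'⟩
      yangBaxter := hβ.yangBaxter hA hτ }
    coassoc := hH.coassoc hA hτ hβ hcr
    counit_left := hH.counit_left hA hβ
    counit_right := hH.counit_right hA hεr
    antipode_left := hH.antipode_left hA hτ hβ
    antipode_right := hH.antipode_right hA hτ hβ hSl
    comul_mul := hH.comul_mul hA hβ
    comul_one := hΔ1
    counit_mul := map_mul ε
    counit_one := map_one ε
    braiding_one_left := hβ.one_tmul
    braiding_one_right := hβ.tmul_one
    counit_braiding_left := TensorProduct.ext' fun a x => by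
      simpa using hH.counit_braiding hA hβ x a
    counit_braiding_right := hεr
    braiding_antipode_left := hSl
    braiding_antipode_right := TensorProduct.ext' fun a x =>
      (hH.natAt_antipode hA hτ hβ hβ (hβ.natAt_self hA hτ) x a).symm
    braiding_mul_left := hβ.mul_left
    braiding_mul_right := hβ.mul_right
    comul_braiding_right := hcr
    comul_braiding_left := hH.comul_braiding_left hA hτ hβ }, c, hβ, hH, rfl⟩

end Axioms

/-! ### Morphisms, and the braiding of Hecke type -/

section Hom

universe u v

variable {F : Type u} [Field F] {V : Type v} [AddCommGroup V] [Module F V]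
  {A A' : Type (max u v)} [Ring A] [Algebra F A] [Ring A'] [Algebra F A']
  {i : V →ₗ[F] A} {i' : V →ₗ[F] A'} {Q : Prop} {τ : V ⊗[F] V →ₗ[F] V ⊗[F] V}
  {c : A ⊗[F] V →ₗ[F] V ⊗[F] A} {c' : A' ⊗[F] V →ₗ[F] V ⊗[F] A'}

lemma map_rmul (f : A →ₐ[F] A') (y : A) (z : A ⊗[F] A) :
    TensorProduct.map f.toLinearMap f.toLinearMap (rmul A y z) =
      rmul A' (f y) (TensorProduct.map f.toLinearMap f.toLinearMap z) := by
  induction z using TensorProduct.induction_on with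
  | zero => simp only [map_zero]
  | add _ _ h₁ h₂ => simp only [map_add, h₁, h₂]
  | tmul a b => simp

lemma map_lmul (f : A →ₐ[F] A') (y : A) (z : A ⊗[F] A) :
    TensorProduct.map f.toLinearMap f.toLinearMap (lmul A y z) =
      lmul A' (f y) (TensorProduct.map f.toLinearMap f.toLinearMap z) := by
  induction z using TensorProduct.induction_on with
  | zero => simp only [map_zero]
  | add _ _ h₁ h₂ => simp only [map_add, h₁, h₂]
  | tmul a b => simp

lemma map_mul' (f : A →ₐ[F] A') (z : A ⊗[F] A) :
    f (LinearMap.mul' F A z) =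
      LinearMap.mul' F A' (TensorProduct.map f.toLinearMap f.toLinearMap z) := by
  induction z using TensorProduct.induction_on with
  | zero => simp only [map_zero]
  | add _ _ h₁ h₂ => simp only [map_add, h₁, h₂]
  | tmul a b => simp

/-- A homomorphism of algebras that is compatible with the generators commutes with the induced
braidings. -/
theorem IsInducedBraiding.map_apply {β : A ⊗[F] A →ₗ[F] A ⊗[F] A}
    {β' : A' ⊗[F] A' →ₗ[F] A' ⊗[F] A'} (hA : IsPresented i Q) (hβ : IsInducedBraiding i τ c β)
    (hβ' : IsInducedBraiding i' τ c' β') {f : A →ₐ[F] A'} (hf : ∀ v, f (i v) = i' v) (x y : A) :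
    TensorProduct.map f.toLinearMap f.toLinearMap (β (x ⊗ₜ y)) = β' (f x ⊗ₜ f y) := by
  have hfi : f.toLinearMap ∘ₗ i = i' := LinearMap.ext hf
  have hgen : ∀ x w, TensorProduct.map f.toLinearMap f.toLinearMap (β (x ⊗ₜ i w)) =
      β' (f x ⊗ₜ i' w) := by
    refine mem_of_adjoin_eq_top hA.adjoin ?_ ?_ ?_ ?_ ?_
    · intro w
      simp [hβ.one_tmul, hβ'.one_tmul, hf]
    · intro v w
      have h1 := LinearMap.congr_fun hβ.restrict (v ⊗ₜ w)
      have h2 := LinearMap.congr_fun hβ'.restrict (v ⊗ₜ w)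
      simp only [LinearMap.comp_apply, TensorProduct.map_tmul] at h1 h2
      rw [h1, hf, h2, ← LinearMap.comp_apply, ← TensorProduct.map_comp, hfi]
    · intro x y hx hy w
      simp only [map_add, TensorProduct.add_tmul, hx, hy]
    · intro r x hx w
      simp only [map_smul, ← TensorProduct.smul_tmul', hx]
    · intro x y hx hy w
      rw [hβ.mul_tmul, map_mul, hβ'.mul_tmul, ← hy, ← hβ.tmul_gen]
      generalize c (y ⊗ₜ w) = z
      induction z using TensorProduct.induction_on with
      | zero => simp only [map_zero]
      | add _ _ h₁ h₂ => simp only [map_add, h₁, h₂]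
      | tmul u b =>
        rw [LinearMap.rTensor_tmul, slide_tmul, map_rmul, hx, TensorProduct.map_tmul, slide_tmul]
        simp [hf]
  revert x
  revert y
  refine mem_of_adjoin_eq_top hA.adjoin ?_ ?_ ?_ ?_ ?_
  · intro x
    simp [hβ.tmul_one, hβ'.tmul_one]
  · intro w x
    rw [hgen, hf]
  · intro x y hx hy w
    simp only [map_add, TensorProduct.tmul_add, hx, hy]
  · intro r x hx w
    simp only [map_smul, TensorProduct.tmul_smul, hx]
  · intro y₁ y₂ h₁ h₂ x
    rw [hβ.tmul_mul, map_mul, hβ'.tmul_mul, ← h₁]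
    generalize β (x ⊗ₜ y₁) = z
    induction z using TensorProduct.induction_on with
    | zero => simp only [map_zero]
    | add _ _ h₁ h₂ => simp only [map_add, h₁, h₂]
    | tmul s t =>
      rw [slideR_tmul, map_lmul, h₂, TensorProduct.map_tmul, slideR_tmul]
      rfl

/-- A homomorphism of algebras that is compatible with the generators is a morphism of braided Hopf
algebras, since all structure maps are determined by recursion on words. -/
theorem isHom_of_gen (hA : IsPresented i Q) {ε : A →ₐ[F] F} {ε' : A' →ₐ[F] F}
    {T : BraidedHopfStructure F A} {L : BraidedHopfStructure F A'}
    (hβ : IsInducedBraiding i τ c T.braiding) (hβ' : IsInducedBraiding i' τ c' L.braiding)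
    (hT : IsHopfData i T.braiding T.comul ε T.antipode) (hTε : T.counit = ε.toLinearMap)
    (hL : IsHopfData i' L.braiding L.comul ε' L.antipode) (hLε : L.counit = ε'.toLinearMap)
    {f : A →ₐ[F] A'} (hf : ∀ v, f (i v) = i' v) : T.IsHom L f where
  braiding := TensorProduct.ext' fun x y => hβ.map_apply hA hβ' hf x y
  comul := by
    refine LinearMap.ext (mem_of_gen_mul hA.adjoin ?_ ?_ ?_ ?_)
    · simp [hT.comul_one, hL.comul_one]
    · intro x y hx hy
      rw [map_add, hx, hy, map_add]
    · intro r x hx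
      rw [map_smul, hx, map_smul]
    · intro v x hx
      simp only [LinearMap.comp_apply, AlgHom.toLinearMap_apply] at hx ⊢
      rw [hT.comul_gen_mul, map_mul, hf, hL.comul_gen_mul, ← hx]
      generalize T.comul x = z
      induction z using TensorProduct.induction_on with
      | zero => simp only [map_zero]
      | add _ _ h₁ h₂ => simp only [map_add, h₁, h₂]
      | tmul s t =>
        rw [primMul_apply, slide_tmul, map_add, map_rmul, hβ.map_apply hA hβ' hf, hf, map_lmul, hf,
          TensorProduct.map_tmul, primMul_apply, slide_tmul]
        rfl
  counit := by
    rw [hTε, hLε]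
    refine LinearMap.ext (mem_of_gen_mul hA.adjoin ?_ ?_ ?_ ?_)
    · simp
    · intro x y hx hy
      rw [map_add, hx, hy, map_add]
    · intro r x hx
      rw [map_smul, hx, map_smul]
    · intro v x _
      simp [hf, hT.counit_gen, hL.counit_gen]
  antipode := by
    refine LinearMap.ext (mem_of_gen_mul hA.adjoin ?_ ?_ ?_ ?_)
    · simp [hT.antipode_one, hL.antipode_one]
    · intro x y hx hy
      rw [map_add, hx, hy, map_add]
    · intro r x hx
      rw [map_smul, hx, map_smul]
    · intro v x hx
      simp only [LinearMap.comp_apply, AlgHom.toLinearMap_apply] at hx ⊢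
      rw [hT.antipode_gen_mul, map_mul, hf, hL.antipode_gen_mul, ← hx, map_neg, map_mul',
        hβ.map_apply hA hβ' hf, hf]

end Hom

section Hecke

variable {F : Type*} [Field F] {V : Type*} [AddCommGroup V] [Module F V] {I : Type*} [LinearOrder I]
  (B : Module.Basis I F V) (p : F)

lemma heckeBraiding_basis (a b : I) : heckeBraiding B p (B a ⊗ₜ B b) =
    (p ^ theta a b - 1) • (B a ⊗ₜ[F] B b) - p ^ theta b a • (B b ⊗ₜ[F] B a) := by
  have := (B.tensorProduct B).constr_basis F (fun ab : I × I =>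
    (p ^ theta ab.1 ab.2 - 1) • (B ab.1 ⊗ₜ[F] B ab.2) -
      p ^ theta ab.2 ab.1 • (B ab.2 ⊗ₜ[F] B ab.1)) (a, b)
  simpa [heckeBraiding] using this

lemma heckeBraiding_self (a : I) : heckeBraiding B p (B a ⊗ₜ B a) = -(B a ⊗ₜ B a) := by
  simp [heckeBraiding_basis, theta]

lemma heckeBraiding_of_lt {a b : I} (h : a < b) :
    heckeBraiding B p (B a ⊗ₜ B b) = -(p • (B b ⊗ₜ[F] B a)) := by
  simp [heckeBraiding_basis, theta, h, not_lt.mpr h.le]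

lemma heckeBraiding_of_gt {a b : I} (h : a < b) :
    heckeBraiding B p (B b ⊗ₜ B a) = (p - 1) • (B b ⊗ₜ[F] B a) - B a ⊗ₜ B b := by
  simp [heckeBraiding_basis, theta, h, not_lt.mpr h.le]

theorem heckeBraiding_yangBaxter :
    braid₁₂ V (heckeBraiding B p) ∘ₗ braid₂₃ (heckeBraiding B p) ∘ₗ braid₁₂ V (heckeBraiding B p) =
      braid₂₃ (heckeBraiding B p) ∘ₗ braid₁₂ V (heckeBraiding B p) ∘ₗ
        braid₂₃ (heckeBraiding B p) := by
  refine (B.tensorProduct (B.tensorProduct B)).ext fun ⟨a, b, c⟩ => ?_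
  have h12 : ∀ x y z, braid₁₂ V (heckeBraiding B p) (x ⊗ₜ (y ⊗ₜ z)) =
    TensorProduct.assoc F V V V (heckeBraiding B p (x ⊗ₜ y) ⊗ₜ z) := fun x y z => rfl
  have h23 : ∀ x z, braid₂₃ (heckeBraiding B p) (x ⊗ₜ z) =
    x ⊗ₜ heckeBraiding B p z := fun x z => rfl
  simp only [Module.Basis.tensorProduct_apply, LinearMap.comp_apply]
  rcases lt_trichotomy a b with hab | hab | hab <;>
  rcases lt_trichotomy b c with hbc | hbc | hbc <;>
  rcases lt_trichotomy a c with hac | hac | hac <;>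
  first
  | (exfalso; order)
  | (subst_vars
     simp only [heckeBraiding_self, heckeBraiding_of_lt, heckeBraiding_of_gt, *,
      TensorProduct.neg_tmul, TensorProduct.tmul_neg, TensorProduct.sub_tmul,
      TensorProduct.tmul_sub, map_neg, map_sub, map_smul, TensorProduct.tmul_smul,
      ← TensorProduct.smul_tmul', TensorProduct.assoc_tmul]
     try module)

/-- The Hecke relation `(τ + 1)(τ - p) = 0`. -/
lemma heckeBraiding_sq : heckeBraiding B p ∘ₗ heckeBraiding B p =
    (p - 1) • heckeBraiding B p + p • LinearMap.id := by
  refine (B.tensorProduct B).ext fun ⟨a, b⟩ => ?_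
  simp only [Module.Basis.tensorProduct_apply, LinearMap.comp_apply, LinearMap.add_apply,
    LinearMap.smul_apply, LinearMap.id_apply]
  rcases lt_trichotomy a b with hab | rfl | hab
  · simp only [heckeBraiding_of_lt B p hab, heckeBraiding_of_gt B p hab, map_neg, map_smul]
    module
  · simp only [heckeBraiding_self, map_neg]
    module
  · simp only [heckeBraiding_of_lt B p hab, heckeBraiding_of_gt B p hab, map_sub, map_smul]
    module

variable {p} in
lemma exists_heckeBraiding_inverse (hp : p ≠ 0) : ∃ τ' : V ⊗[F] V →ₗ[F] V ⊗[F] V,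
    heckeBraiding B p ∘ₗ τ' = LinearMap.id ∧ τ' ∘ₗ heckeBraiding B p = LinearMap.id := by
  refine ⟨p⁻¹ • (heckeBraiding B p - (p - 1) • LinearMap.id), ?_, ?_⟩
  · rw [LinearMap.comp_smul, LinearMap.comp_sub, heckeBraiding_sq, LinearMap.comp_smul,
      LinearMap.comp_id, add_sub_cancel_left, smul_smul, inv_mul_cancel₀ hp, one_smul]
  · rw [LinearMap.smul_comp, LinearMap.sub_comp, heckeBraiding_sq, LinearMap.smul_comp,
      LinearMap.id_comp, add_sub_cancel_left, smul_smul, inv_mul_cancel₀ hp, one_smul]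

variable {B} in
/-- A bilinear map is alternating if it is so on basis vectors. -/
lemma apply_self_eq_zero_of_basis {M : Type*} [AddCommGroup M] [Module F M]
    {f : V →ₗ[F] V →ₗ[F] M} (h₀ : ∀ a, f (B a) (B a) = 0)
    (h : ∀ a b, a < b → f (B a) (B b) + f (B b) (B a) = 0) (v : V) : f v v = 0 := by
  have hflip : f + f.flip = 0 := by
    refine B.ext fun a => B.ext fun b => ?_
    simp only [LinearMap.add_apply, LinearMap.flip_apply, LinearMap.zero_apply]
    rcases lt_trichotomy a b with hab | rfl | hab
    · exact h a b hab
    · simp [h₀]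
    · rw [add_comm]
      exact h b a hab
  have hv : v ∈ Submodule.span F (Set.range B) := B.mem_span v
  induction hv using Submodule.span_induction with
  | mem x hx => obtain ⟨a, rfl⟩ := hx; exact h₀ a
  | zero => simp
  | add x y _ _ hx hy =>
    have := LinearMap.congr_fun (LinearMap.congr_fun hflip x) y
    simp only [LinearMap.add_apply, LinearMap.flip_apply, LinearMap.zero_apply] at this
    simp only [map_add, LinearMap.add_apply, hx, hy, zero_add, add_zero]
    rw [add_comm]
    exact this
  | smul r x _ hx => simp [hx]

/-- The tensors `a ⊗ b + b ⊗ a`, for `a < b`, and `a ⊗ a`, which span the kernel of `id + τ`. -/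
def skewTensors : Set (V ⊗[F] V) :=
  {w | ∃ a b : I, a < b ∧ w = B a ⊗ₜ[F] B b + B b ⊗ₜ[F] B a} ∪ {w | ∃ a : I, w = B a ⊗ₜ[F] B a}

lemma add_heckeBraiding_of_mem {z : V ⊗[F] V} (hz : z ∈ Submodule.span F (skewTensors B)) :
    z + heckeBraiding B p z = 0 := by
  suffices h : Submodule.span F (skewTensors B) ≤
      LinearMap.ker (LinearMap.id + heckeBraiding B p) from h hz
  rw [Submodule.span_le]
  rintro _ (⟨a, b, hab, rfl⟩ | ⟨a, rfl⟩)
  · simp only [SetLike.mem_coe, LinearMap.mem_ker, LinearMap.add_apply, LinearMap.id_apply, map_add,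
      heckeBraiding_of_lt B p hab, heckeBraiding_of_gt B p hab]
    module
  · simp [heckeBraiding_self]

/-- `id + τ` has a left inverse modulo `skewTensors`; hence these tensors contain its kernel. -/
lemma exists_sub_mem_span_skewTensors : ∃ s : V ⊗[F] V →ₗ[F] V ⊗[F] V,
    ∀ z, z - s (z + heckeBraiding B p z) ∈ Submodule.span F (skewTensors B) := by
  -- `s` is the projection to the span of the `a ⊗ b` with `a < b`.
  let s : V ⊗[F] V →ₗ[F] V ⊗[F] V := (B.tensorProduct B).constr F fun ab : I × I =>
    if ab.1 < ab.2 then B ab.1 ⊗ₜ[F] B ab.2 else 0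
  have hs : ∀ a b, s (B a ⊗ₜ B b) = if a < b then B a ⊗ₜ[F] B b else 0 := by
    intro a b
    have := (B.tensorProduct B).constr_basis F (fun ab : I × I =>
      if ab.1 < ab.2 then B ab.1 ⊗ₜ[F] B ab.2 else 0) (a, b)
    rwa [Module.Basis.tensorProduct_apply] at this
  refine ⟨s, ?_⟩
  suffices h : (Submodule.span F (skewTensors B)).mkQ ∘ₗ
      (LinearMap.id - s ∘ₗ (LinearMap.id + heckeBraiding B p)) = 0 by
    intro z
    rw [← Submodule.Quotient.mk_eq_zero]
    exact LinearMap.congr_fun h z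
  refine (B.tensorProduct B).ext fun ⟨a, b⟩ => ?_
  rw [LinearMap.comp_apply, LinearMap.zero_apply, Submodule.mkQ_apply,
    Submodule.Quotient.mk_eq_zero]
  simp only [Module.Basis.tensorProduct_apply, LinearMap.comp_apply, LinearMap.add_apply,
    LinearMap.sub_apply, LinearMap.id_apply]
  rcases lt_trichotomy a b with hab | rfl | hab
  · simp [heckeBraiding_of_lt B p hab, hs, hab, not_lt.mpr hab.le]
  · simp only [heckeBraiding_self, add_neg_cancel, map_zero, sub_zero]
    exact Submodule.subset_span (Or.inr ⟨a, rfl⟩)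
  · refine Submodule.subset_span (Or.inl ⟨b, a, hab, ?_⟩)
    simp [heckeBraiding_of_gt B p hab, hs, hab, not_lt.mpr hab.le, add_comm]

theorem isSkewBraiding_heckeBraiding : IsSkewBraiding (heckeBraiding B p) where
  yangBaxter := heckeBraiding_yangBaxter B p
  sq v := by
    rw [eq_neg_iff_add_eq_zero]
    refine apply_self_eq_zero_of_basis (B := B)
      (f := TensorProduct.curry (heckeBraiding B p + LinearMap.id)) ?_ ?_ v
    · intro a
      simp [heckeBraiding_self]
    · intro a b hab
      simp only [TensorProduct.curry_apply, LinearMap.add_apply, LinearMap.id_apply,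
        heckeBraiding_of_lt B p hab, heckeBraiding_of_gt B p hab]
      module
  factor := by
    obtain ⟨s, hs⟩ := exists_sub_mem_span_skewTensors B p
    refine ⟨s, fun z => ?_⟩
    suffices h : Submodule.span F (skewTensors B) ≤
      Submodule.span F {w | ∃ v : V, w = v ⊗ₜ[F] v} from h (hs z)
    rw [Submodule.span_le]
    rintro _ (⟨a, b, -, rfl⟩ | ⟨a, rfl⟩)
    · have h : B a ⊗ₜ[F] B b + B b ⊗ₜ[F] B a =
          (B a + B b) ⊗ₜ (B a + B b) - B a ⊗ₜ B a - B b ⊗ₜ B b := by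
        simp only [TensorProduct.add_tmul, TensorProduct.tmul_add]
        abel
      rw [h]
      exact sub_mem (sub_mem (Submodule.subset_span ⟨_, rfl⟩) (Submodule.subset_span ⟨_, rfl⟩))
        (Submodule.subset_span ⟨_, rfl⟩)
    · exact Submodule.subset_span ⟨_, rfl⟩

end Hecke

/-! ### The tensor algebra and the exterior algebra -/

section Presentations

universe u v

variable {F : Type u} [Field F] {V : Type v} [AddCommGroup V] [Module F V]

lemma isPresented_tensorAlgebra : IsPresented (TensorAlgebra.ι F (M := V)) False where
  adjoin := TensorAlgebra.adjoin_range_ι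
  sq h := h.elim
  lift _ _ _ f _ := ⟨TensorAlgebra.lift F f, fun v => TensorAlgebra.lift_ι_apply f v⟩

lemma isPresented_exteriorAlgebra : IsPresented (ExteriorAlgebra.ι F (M := V)) True where
  adjoin := by
    rw [eq_top_iff]
    rintro x -
    induction x using ExteriorAlgebra.induction with
    | algebraMap r => exact Subalgebra.algebraMap_mem _ r
    | ι v => exact Algebra.subset_adjoin ⟨v, rfl⟩
    | mul a b ha hb => exact mul_mem ha hb
    | add a b ha hb => exact add_mem ha hb
  sq _ v := ExteriorAlgebra.ι_sq_zero v
  lift _ _ _ f hf := ⟨ExteriorAlgebra.lift F ⟨f, hf trivial⟩,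
    fun v => ExteriorAlgebra.lift_ι_apply F f (hf trivial) v⟩

variable {A : Type (max u v)} [Ring A] [Algebra F A] {i : V →ₗ[F] A} {Q : Prop}
  {τ : V ⊗[F] V →ₗ[F] V ⊗[F] V} {c : A ⊗[F] V →ₗ[F] V ⊗[F] A} {T : BraidedHopfStructure F A}

lemma IsInducedBraiding.isInducedBy (hβ : IsInducedBraiding i τ c T.braiding) :
    T.IsInducedBy i τ where
  restrict := hβ.restrict
  unit_left := hβ.one_tmul
  unit_right := hβ.tmul_one
  fusion := hβ.fusion

/-- The tensor `t + τ t` is the obstruction to primitivity of the element of degree two represented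
by `t`. -/
lemma IsHopfData.comul_degree_two {ε : A →ₐ[F] F} (hβ : IsInducedBraiding i τ c T.braiding)
    (hT : IsHopfData i T.braiding T.comul ε T.antipode) (t : V ⊗[F] V) :
    T.comul (LinearMap.mul' F A (TensorProduct.map i i t)) =
      LinearMap.mul' F A (TensorProduct.map i i t) ⊗ₜ 1 +
        1 ⊗ₜ LinearMap.mul' F A (TensorProduct.map i i t) + TensorProduct.map i i (t + τ t) := by
  induction t using TensorProduct.induction_on with
  | zero => simp
  | add _ _ h₁ h₂ =>
    simp only [map_add, h₁, h₂, TensorProduct.add_tmul, TensorProduct.tmul_add]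
    abel
  | tmul v w =>
    have h := LinearMap.congr_fun hβ.restrict (v ⊗ₜ w)
    simp only [LinearMap.comp_apply, TensorProduct.map_tmul] at h
    rw [TensorProduct.map_tmul, LinearMap.mul'_apply, hT.comul_gen_mul, hT.comul_gen hβ,
      primMul_apply, map_add, map_add, slide_tmul, slide_tmul, hβ.tmul_one, h, rmul_one, map_add]
    simp only [lmul_tmul, rmul_tmul, mul_one, TensorProduct.map_tmul]
    abel

end Presentations

section Exterior

variable {F : Type*} [Field F] {V : Type*} [AddCommGroup V] [Module F V] {I : Type*} [LinearOrder I]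
  (B : Module.Basis I F V) (p : F)

lemma mem_range_ι_sq_iff {w : TensorAlgebra F V} :
    w ∈ LinearMap.range (TensorAlgebra.ι F (M := V)) ^ 2 ↔
      ∃ t, LinearMap.mul' F _ (TensorProduct.map (TensorAlgebra.ι F) (TensorAlgebra.ι F) t) =
        w := by
  constructor
  · intro hw
    suffices h : LinearMap.range (TensorAlgebra.ι F (M := V)) ^ 2 ≤ LinearMap.range
      (LinearMap.mul' F (TensorAlgebra F V) ∘ₗ
        TensorProduct.map (TensorAlgebra.ι F) (TensorAlgebra.ι F)) from h hw
    rw [pow_two, Submodule.mul_le]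
    rintro _ ⟨v, rfl⟩ _ ⟨w, rfl⟩
    exact ⟨v ⊗ₜ w, by simp⟩
  · rintro ⟨t, rfl⟩
    rw [pow_two]
    induction t using TensorProduct.induction_on with
    | zero => simp
    | add _ _ h₁ h₂ => simpa only [map_add] using add_mem h₁ h₂
    | tmul v w =>
      rw [TensorProduct.map_tmul, LinearMap.mul'_apply]
      exact Submodule.mul_mem_mul (LinearMap.mem_range_self _ v) (LinearMap.mem_range_self _ w)

lemma map_ι_injective : Function.Injective
    (TensorProduct.map (TensorAlgebra.ι F (M := V)) (TensorAlgebra.ι F (M := V))) := by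
  have h : TensorAlgebra.ιInv ∘ₗ TensorAlgebra.ι F (M := V) = LinearMap.id :=
    LinearMap.ext TensorAlgebra.ι_leftInverse
  refine Function.LeftInverse.injective
    (g := TensorProduct.map (TensorAlgebra.ιInv (R := F) (M := V)) TensorAlgebra.ιInv) fun t => ?_
  rw [← LinearMap.comp_apply, ← TensorProduct.map_comp, h, TensorProduct.map_id, LinearMap.id_apply]

lemma span_exteriorRelations : Submodule.span F (exteriorRelations B) =
    (Submodule.span F (skewTensors B)).map (LinearMap.mul' F (TensorAlgebra F V) ∘ₗ
      TensorProduct.map (TensorAlgebra.ι F) (TensorAlgebra.ι F)) := by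
  rw [Submodule.map_span]
  congr 1
  ext w
  constructor
  · rintro (⟨a, b, hab, rfl⟩ | ⟨a, rfl⟩)
    · exact ⟨_, Or.inl ⟨a, b, hab, rfl⟩, by simp⟩
    · exact ⟨_, Or.inr ⟨a, rfl⟩, by simp⟩
  · rintro ⟨_, ⟨a, b, hab, rfl⟩ | ⟨a, rfl⟩, rfl⟩
    · exact Or.inl ⟨a, b, hab, by simp⟩
    · exact Or.inr ⟨a, by simp⟩

theorem setOf_isPrimitive_eq_span_exteriorRelations {T : BraidedHopfStructure F (TensorAlgebra F V)}
    {c : TensorAlgebra F V ⊗[F] V →ₗ[F] V ⊗[F] TensorAlgebra F V} {ε : TensorAlgebra F V →ₐ[F] F}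
    (hβ : IsInducedBraiding (TensorAlgebra.ι F) (heckeBraiding B p) c T.braiding)
    (hT : IsHopfData (TensorAlgebra.ι F) T.braiding T.comul ε T.antipode) :
    {w | w ∈ LinearMap.range (TensorAlgebra.ι F (M := V)) ^ 2 ∧ T.IsPrimitive w} =
      (Submodule.span F (exteriorRelations B) : Set (TensorAlgebra F V)) := by
  have hprim : ∀ t, T.IsPrimitive (LinearMap.mul' F _
      (TensorProduct.map (TensorAlgebra.ι F) (TensorAlgebra.ι F) t)) ↔
      t + heckeBraiding B p t = 0 := by
    intro t
    rw [BraidedHopfStructure.IsPrimitive, hT.comul_degree_two hβ, add_eq_left,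
      map_eq_zero_iff _ map_ι_injective]
  ext w
  rw [Set.mem_ofPred_eq, mem_range_ι_sq_iff, span_exteriorRelations]
  constructor
  · rintro ⟨⟨t, rfl⟩, ht⟩
    obtain ⟨s, hs⟩ := exists_sub_mem_span_skewTensors B p
    have := hs t
    rw [(hprim t).mp ht, map_zero, sub_zero] at this
    exact ⟨t, this, rfl⟩
  · rintro ⟨t, ht, rfl⟩
    exact ⟨⟨t, rfl⟩, (hprim t).mpr (add_heckeBraiding_of_mem B p ht)⟩

lemma toExterior_surjective :
    Function.Surjective (TensorAlgebra.toExterior (R := F) (M := V)) := by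
  intro x
  induction x using ExteriorAlgebra.induction with
  | algebraMap r => exact ⟨algebraMap F _ r, by simp⟩
  | ι v => exact ⟨TensorAlgebra.ι F v, by simp⟩
  | mul a b ha hb =>
    obtain ⟨x, rfl⟩ := ha
    obtain ⟨y, rfl⟩ := hb
    exact ⟨x * y, map_mul _ _ _⟩
  | add a b ha hb =>
    obtain ⟨x, rfl⟩ := ha
    obtain ⟨y, rfl⟩ := hb
    exact ⟨x + y, map_add _ _ _⟩

theorem ker_toExterior : TwoSidedIdeal.ker (TensorAlgebra.toExterior (R := F) (M := V)) =
    TwoSidedIdeal.span (exteriorRelations B) := by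
  apply le_antisymm
  · -- The quotient by the relations is a quotient of the exterior algebra.
    intro x hx
    rw [TwoSidedIdeal.mem_ker] at hx
    set J := TwoSidedIdeal.span (exteriorRelations B)
    let π : TensorAlgebra F V →ₐ[F] J.ringCon.Quotient := RingCon.mkₐ F J.ringCon
    have hπ : ∀ x, π x = 0 ↔ x ∈ J := by
      intro x
      rw [TwoSidedIdeal.mem_iff, ← RingCon.eq]
      rfl
    have hrel : ∀ x ∈ exteriorRelations B, π x = 0 := fun x hx =>
      (hπ x).mpr (TwoSidedIdeal.subset_span hx)
    have hsq : ∀ v, π (TensorAlgebra.ι F v) * π (TensorAlgebra.ι F v) = 0 := by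
      refine apply_self_eq_zero_of_basis (B := B)
        (f := (LinearMap.mul F J.ringCon.Quotient).compl₁₂ (π.toLinearMap ∘ₗ TensorAlgebra.ι F)
          (π.toLinearMap ∘ₗ TensorAlgebra.ι F)) ?_ ?_
      · intro a
        simpa using hrel _ (Or.inr ⟨a, rfl⟩)
      · intro a b hab
        simpa using hrel _ (Or.inl ⟨a, b, hab, rfl⟩)
    let g : ExteriorAlgebra F V →ₐ[F] J.ringCon.Quotient :=
      ExteriorAlgebra.lift F ⟨π.toLinearMap ∘ₗ TensorAlgebra.ι F, hsq⟩
    have hg : g.comp TensorAlgebra.toExterior = π := by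
      refine TensorAlgebra.hom_ext (LinearMap.ext fun v => ?_)
      simp only [AlgHom.comp_toLinearMap, LinearMap.comp_apply, AlgHom.toLinearMap_apply,
        TensorAlgebra.toExterior_ι]
      exact ExteriorAlgebra.lift_ι_apply F _ hsq v
    rw [← hπ, ← hg, AlgHom.comp_apply, hx, map_zero]
  · rw [TwoSidedIdeal.span_le]
    rintro _ (⟨a, b, -, rfl⟩ | ⟨a, rfl⟩)
    · simp [TwoSidedIdeal.mem_ker, ExteriorAlgebra.ι_add_mul_swap]
    · simp [TwoSidedIdeal.mem_ker]

end Exterior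

end BraidedExterior

end

theorem mainTheorem1 {F : Type*} [Field F] {V : Type*} [AddCommGroup V] [Module F V]
    {I : Type*} [LinearOrder I] (B : Module.Basis I F V) (p : F) (hp : p ≠ 0) :
    BraidedExterior.IsBraidedVectorSpace (BraidedExterior.heckeBraiding B p) ∧
    ∃ (T : BraidedExterior.BraidedHopfStructure F (TensorAlgebra F V))
      (L : BraidedExterior.BraidedHopfStructure F (ExteriorAlgebra F V)),
      -- the braided Hopf algebra `T(V)` and its primitive elements of degree two
      (∀ v : V, T.IsPrimitive (TensorAlgebra.ι F v)) ∧
      T.IsInducedBy (TensorAlgebra.ι F) (BraidedExterior.heckeBraiding B p) ∧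
      {w | w ∈ LinearMap.range (TensorAlgebra.ι F (M := V)) ^ 2 ∧ T.IsPrimitive w} =
        (Submodule.span F (BraidedExterior.exteriorRelations B) : Set (TensorAlgebra F V)) ∧
      -- the braided Hopf algebra `⋀ V`
      (∀ v : V, L.IsPrimitive (ExteriorAlgebra.ι F v)) ∧
      L.IsInducedBy (ExteriorAlgebra.ι F) (BraidedExterior.heckeBraiding B p) ∧
      -- `⋀ V` is the quotient of the braided Hopf algebra `T(V)` by the ideal
      T.IsHom L (TensorAlgebra.toExterior (R := F) (M := V)) ∧
      Function.Surjective (TensorAlgebra.toExterior (R := F) (M := V)) ∧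
      TwoSidedIdeal.ker (TensorAlgebra.toExterior (R := F) (M := V)) =
        TwoSidedIdeal.span (BraidedExterior.exteriorRelations B) := by
  obtain ⟨τ', h, h'⟩ := BraidedExterior.exists_heckeBraiding_inverse B hp
  have hτ := BraidedExterior.isSkewBraiding_heckeBraiding B p
  have hτ' := hτ.inverse h h'
  have hT := BraidedExterior.isPresented_tensorAlgebra (F := F) (V := V)
  have hL := BraidedExterior.isPresented_exteriorAlgebra (F := F) (V := V)
  obtain ⟨T, c, hβ, hTd, hTε⟩ := BraidedExterior.exists_braidedHopfStructure hT
    TensorAlgebra.algebraMapInv (fun v => by simp [TensorAlgebra.algebraMapInv]) hτ hτ' h h'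
  obtain ⟨L, d, hγ, hLd, hLε⟩ := BraidedExterior.exists_braidedHopfStructure hL
    ExteriorAlgebra.algebraMapInv (fun v => by simp [ExteriorAlgebra.algebraMapInv]) hτ hτ' h h'
  exact ⟨⟨Function.bijective_iff_has_inverse.mpr
      ⟨τ', LinearMap.congr_fun h', LinearMap.congr_fun h⟩, hτ.yangBaxter⟩,
    T, L, hTd.comul_gen hβ, hβ.isInducedBy,
    BraidedExterior.setOf_isPrimitive_eq_span_exteriorRelations B p hβ hTd,
    hLd.comul_gen hγ, hγ.isInducedBy,
    BraidedExterior.isHom_of_gen hT hβ hγ hTd hTε hLd hLε (fun v => TensorAlgebra.toExterior_ι v),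
    BraidedExterior.toExterior_surjective, BraidedExterior.ker_toExterior B⟩
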